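/- Let $\mathcal D\subseteq\mathbb R$ be an interval (for instance $[0,1]$) and let $\chi$ be a continuous probability distribution (no atoms) concentrated on $\mathcal D$, with c.d.f. $F_\chi(x)=\chi((-\infty,x])$. Work on a real RAM with finitely many working registers holding real numbers, unit-cost arithmetic ($+,-,\times,/$, square root, floor, integer constants), unit-cost comparison, access to the cells of the data array and to its length, access to a stored bit string, and possibly further unit-cost functions $\mathbb R\to\mathbb R$. Suppose that $F_\chi$ can be evaluated exactly at every point of $\mathcal D$ by a program of this machine that performs at most $c$ operations and uses at most $s$ stored bits, where $c$ and $s$ are constants. A learned index consists of a preprocessing map, which assigns to every array $A$ a bit string $\theta_A$ to be stored (its length is the space overhead), and one fixed query program, the same for all arrays and all lengths, which has access to $A$ and $\theta_A$. Then there is a learned index such that (i) for every $n$, every sorted array $A=(a_1\le\dots\le a_n)$ with elements in $\mathcal D$ and every query $q\in\mathbb R$, the query program returns exactly the rank $r_A(q)=\#\{i : a_i\le q\}$; (ii) the space overhead is $O(1)$: it is at most $C$ bits for every $n$ and every such $A$; (iii) for every $n\ge 3$ and every query $q\in\mathbb R$, the expected number of operations performed to answer $q$ is at most $C\log\log n$,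 where the expectation is over arrays $A$ obtained by sorting $n$ independent samples from $\chi$. Here the constant $C$ depends only on $c$ and $s$. -/

import Mathlib

open MeasureTheory ProbabilityTheory
open scoped ENNReal

namespace LearnedIndexing

/-! ### The machine

A real random access machine.  It has registers `0, 1, 2, …` holding real numbers, a read-only
sorted array `A` of `n` real numbers (the data) and a read-only bit string `θ` (the stored
parameters).  A program mentions finitely many registers, so the working memory is a constant
number of registers.  The machine may have further unit-cost operations `prim i : ℝ → ℝ` (`i : ι`)
besides the arithmetic ones; with `ι` empty it is the plain real RAM, and constants such as the
coefficients of a polynomial are constant functions `prim i`. -/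

/-- The contents of the registers. -/
abbrev Registers := ℕ → ℝ

/-- The basic operations; the first register named is the destination. -/
inductive Op (ι : Type*) where
  | const (d : ℕ) (z : ℤ)
  | move (d a : ℕ)
  | add (d a b : ℕ)
  | sub (d a b : ℕ)
  | mul (d a b : ℕ)
  | div (d a b : ℕ)
  | sqrt (d a : ℕ)
  | floor (d a : ℕ)
  | prim (i : ι) (d a : ℕ)
  /-- the length of the array -/
  | len (d : ℕ)
  /-- array access -/
  | read (d a : ℕ)
  /-- access to the stored bits -/
  | bit (d a : ℕ)

/-- The array cell (numbered from `0`) addressed by the number `x`, rounded down;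
`0` beyond the end of the array. -/
noncomputable def cell {n : ℕ} (A : Fin n → ℝ) (x : ℝ) : ℝ :=
  if h : ⌊x⌋₊ < n then A ⟨⌊x⌋₊, h⟩ else 0

/-- The stored bit (numbered from `0`) addressed by the number `x`, rounded down, as `0` or `1`;
`-1` beyond the end of the bit string. -/
noncomputable def storedBit (θ : List Bool) (x : ℝ) : ℝ :=
  match θ[⌊x⌋₊]? with
  | some true => 1
  | some false => 0
  | none => -1

/-- The effect of a basic operation on the registers. -/
noncomputable def Op.exec {ι : Type*} (prim : ι → ℝ → ℝ) {n : ℕ} (A : Fin n → ℝ) (θ : List Bool)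
    (σ : Registers) : Op ι → Registers
  | .const d z => Function.update σ d (z : ℝ)
  | .move d a => Function.update σ d (σ a)
  | .add d a b => Function.update σ d (σ a + σ b)
  | .sub d a b => Function.update σ d (σ a - σ b)
  | .mul d a b => Function.update σ d (σ a * σ b)
  | .div d a b => Function.update σ d (σ a / σ b)
  | .sqrt d a => Function.update σ d (Real.sqrt (σ a))
  | .floor d a => Function.update σ d (⌊σ a⌋ : ℝ)
  | .prim i d a => Function.update σ d (prim i (σ a))
  | .len d => Function.update σ d (n : ℝ)
  | .read d a => Function.update σ d (cell A (σ a))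
  | .bit d a => Function.update σ d (storedBit θ (σ a))

/-- Programs. `ite a b P Q` runs `P` if register `a` is at most register `b` and `Q` otherwise;
`loop a b P` repeats `P` as long as register `a` is less than register `b`. -/
inductive Prog (ι : Type*) where
  | op (o : Op ι)
  | seq (P Q : Prog ι)
  | ite (a b : ℕ) (P Q : Prog ι)
  | loop (a b : ℕ) (P : Prog ι)

/-- `Run prim A θ P σ t τ`: started with register contents `σ`, the program `P` halts with register
contents `τ` after exactly `t` operations.  Every basic operation and every comparison counts
as one operation. -/
inductive Run {ι : Type*} (prim : ι → ℝ → ℝ) {n : ℕ} (A : Fin n → ℝ) (θ : List Bool) :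
    Prog ι → Registers → ℕ → Registers → Prop where
  | op (o : Op ι) (σ : Registers) : Run prim A θ (.op o) σ 1 (o.exec prim A θ σ)
  | seq {P Q : Prog ι} {σ τ υ : Registers} {s t : ℕ} :
      Run prim A θ P σ s τ → Run prim A θ Q τ t υ → Run prim A θ (.seq P Q) σ (s + t) υ
  | ite_true {a b : ℕ} {P Q : Prog ι} {σ τ : Registers} {t : ℕ} :
      σ a ≤ σ b → Run prim A θ P σ t τ → Run prim A θ (.ite a b P Q) σ (t + 1) τ
  | ite_false {a b : ℕ} {P Q : Prog ι} {σ τ : Registers} {t : ℕ} :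
      σ b < σ a → Run prim A θ Q σ t τ → Run prim A θ (.ite a b P Q) σ (t + 1) τ
  | loop_done {a b : ℕ} {P : Prog ι} {σ : Registers} :
      σ b ≤ σ a → Run prim A θ (.loop a b P) σ 1 σ
  | loop_step {a b : ℕ} {P : Prog ι} {σ τ υ : Registers} {s t : ℕ} :
      σ a < σ b → Run prim A θ P σ s τ → Run prim A θ (.loop a b P) τ t υ →
      Run prim A θ (.loop a b P) σ (s + t + 1) υ

/-- The machine is deterministic: operation count and result are unique. -/
theorem Run.unique {ι : Type*} {prim : ι → ℝ → ℝ} {n : ℕ} {A : Fin n → ℝ} {θ : List Bool}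
    {P : Prog ι} {σ τ : Registers} {t : ℕ} (h : Run prim A θ P σ t τ) :
    ∀ {t' : ℕ} {τ' : Registers}, Run prim A θ P σ t' τ' → t = t' ∧ τ = τ' := by
  induction h with
  | op o σ => intro t' τ' h'; cases h'; exact ⟨rfl, rfl⟩
  | seq _ _ ih₁ ih₂ =>
    intro t' τ' h'
    cases h' with
    | seq k₁ k₂ =>
      obtain ⟨rfl, rfl⟩ := ih₁ k₁
      obtain ⟨rfl, rfl⟩ := ih₂ k₂
      exact ⟨rfl, rfl⟩
  | ite_true hc _ ih =>
    intro t' τ' h'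
    cases h' with
    | ite_true _ k => obtain ⟨rfl, rfl⟩ := ih k; exact ⟨rfl, rfl⟩
    | ite_false hc' _ => exact absurd hc (not_le.mpr hc')
  | ite_false hc _ ih =>
    intro t' τ' h'
    cases h' with
    | ite_true hc' _ => exact absurd hc' (not_le.mpr hc)
    | ite_false _ k => obtain ⟨rfl, rfl⟩ := ih k; exact ⟨rfl, rfl⟩
  | loop_done hc =>
    intro t' τ' h'
    cases h' with
    | loop_done _ => exact ⟨rfl, rfl⟩
    | loop_step hc' _ _ => exact absurd hc (not_le.mpr hc')
  | loop_step hc _ _ ih₁ ih₂ =>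
    intro t' τ' h'
    cases h' with
    | loop_done hc' => exact absurd hc' (not_le.mpr hc)
    | loop_step _ k₁ k₂ =>
      obtain ⟨rfl, rfl⟩ := ih₁ k₁
      obtain ⟨rfl, rfl⟩ := ih₂ k₂
      exact ⟨rfl, rfl⟩

/-- `F` can be evaluated exactly at all points of `D` with at most `c` operations and `s` stored
bits: some program `P`, used as a subroutine with some stored bit string of length at most `s`,
replaces the number `x ∈ D` in register `0` by `F x`, whatever the other registers and the data
array contain, and performs at most `c` operations. -/
def EvaluableOn {ι : Type*} (prim : ι → ℝ → ℝ) (F : ℝ → ℝ) (D : Set ℝ) (c s : ℕ) : Prop :=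
  ∃ (P : Prog ι) (θ : List Bool), θ.length ≤ s ∧
    ∀ (n : ℕ) (A : Fin n → ℝ) (σ : Registers), σ 0 ∈ D →
      ∃ (t : ℕ) (τ : Registers), t ≤ c ∧ Run prim A θ P σ t τ ∧ τ 0 = F (σ 0)

/-! ### The rank problem and learned indexes -/

/-- The rank of `q` in the array `A`: the number of elements that are at most `q`. -/
noncomputable def rank {n : ℕ} (A : Fin n → ℝ) (q : ℝ) : ℕ :=
  (Finset.univ.filter fun i => A i ≤ q).card

/-- The registers at the beginning of a query: `q` in register `0`, and `0` elsewhere. -/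
def initial (q : ℝ) : Registers := fun r => if r = 0 then q else 0

/-- A learned index: a preprocessing step that computes from the array the parameters to be stored,
as a bit string, and one program, the same for all arrays of all lengths, that answers queries. -/
structure LearnedIndex (ι : Type*) where
  params : ∀ {n : ℕ}, (Fin n → ℝ) → List Bool
  query : Prog ι

namespace LearnedIndex

variable {ι : Type*} (R : LearnedIndex ι)

/-- The index solves the rank problem exactly: for every sorted array with elements in `D` and
every query `q`, the query program halts with the rank of `q` in register `0`. -/
def Correct (prim : ι → ℝ → ℝ) (D : Set ℝ) : Prop :=
  ∀ (n : ℕ) (A : Fin n → ℝ), Monotone A → (∀ i, A i ∈ D) → ∀ q : ℝ,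
    ∃ (t : ℕ) (τ : Registers), Run prim A (R.params A) R.query (initial q) t τ ∧
      τ 0 = (rank A q : ℝ)

/-- The space overhead: the number of bits that are stored in addition to the array. -/
def space {n : ℕ} (A : Fin n → ℝ) : ℕ := (R.params A).length

/-- The number of operations performed to answer the query `q` on the array `A`
(`∞` if the query program does not halt). -/
noncomputable def time (prim : ι → ℝ → ℝ) {n : ℕ} (A : Fin n → ℝ) (q : ℝ) : ℝ≥0∞ :=
  ⨅ (t : ℕ) (τ : Registers) (_ : Run prim A (R.params A) R.query (initial q) t τ), (t : ℝ≥0∞)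

end LearnedIndex

/-- The expectation of a nonnegative quantity, as an upper integral: nothing is assumed about
measurability, and for a measurable quantity it is the usual expectation. -/
noncomputable def expectation {Ω : Type*} [MeasurableSpace Ω] (μ : Measure Ω) (T : Ω → ℝ≥0∞) :
    ℝ≥0∞ :=
  ⨅ (g : Ω → ℝ≥0∞) (_ : Measurable g) (_ : ∀ ω, T ω ≤ g ω), ∫⁻ ω, g ω ∂μ

theorem expectation_eq_lintegral {Ω : Type*} [MeasurableSpace Ω] (μ : Measure Ω)
    {T : Ω → ℝ≥0∞} (hT : Measurable T) : expectation μ T = ∫⁻ ω, T ω ∂μ :=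
  le_antisymm (iInf_le_of_le T (iInf_le_of_le hT (iInf_le_of_le (fun _ => le_rfl) le_rfl)))
    (le_iInf fun _ => le_iInf fun _ => le_iInf fun h => lintegral_mono h)

/-- The expected query time for the query `q`, over arrays obtained by sorting `n` independent
samples from `χ`. -/
noncomputable def LearnedIndex.expectedTime {ι : Type*} (R : LearnedIndex ι) (prim : ι → ℝ → ℝ)
    (χ : Measure ℝ) (n : ℕ) (q : ℝ) : ℝ≥0∞ :=
  expectation (Measure.pi fun _ : Fin n => χ) fun X => R.time prim (X ∘ Tuple.sort X) q

end LearnedIndexing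

/-! Write F for the cdf. Among n samples, the rank of q and the index g of an entry `A g` should
differ by about n(F(q) − F(`A g`)). So a position g with a known error bound can be corrected by one
evaluation of F at an array entry, the new error being only the sampling fluctuation of the number
of entries between `A g` and q. This is a Newton iteration. With the error bound written as w^8, the
corrected position is off by at most 2w^6 (`abs_rank_sub_newton_le`), so after rounding the bound
becomes w^7. Starting from 2^(2^k) ≥ n, the logarithm of the bound shrinks by 7/8 per step, and 6k
steps suffice, with k = O(log log n).

The position g depends on the sample, so the estimate must hold for all g at once. It is therefore
stated through sets that depend on q alone, namely the points at cdf-distance less than δ to the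
left or right of q, with δ in a grid of about w^2 values (`Typical`). Monotonicity of the counts
fills the gaps of the grid (`abs_sub_le_of_grid`). Chebyshev's inequality and a union bound give
failure probability at most 8/w^2.

The iteration stops once w^2 ≤ 16·4^k. Each scale used then fails with probability at most
1/(2·4^k), and all of them together with probability at most 3/2^k. On the good event, binary search
over the remaining error takes 18 + 8k steps. On the bad event the position is useless, but two
array reads detect a wrong bracket and enlarge it, so the answer stays exact and at most 2^k
halvings are needed. Their extra cost 8·2^k contributes only 24 to the expectation. The only stored
bits are those of the evaluator of F. -/

namespace LearnedIndexing

/-! ### Cost-bounded program logic. -/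

section Exec

variable {ι : Type*} {prim : ι → ℝ → ℝ} {n : ℕ} {A : Fin n → ℝ} {θ : List Bool}

/-- Started in `σ`, the program `P` halts after at most `t` operations in a state satisfying `Q`. -/
def Exec (prim : ι → ℝ → ℝ) (A : Fin n → ℝ) (θ : List Bool) (P : Prog ι) (σ : Registers) (t : ℕ)
    (Q : Registers → Prop) : Prop :=
  ∃ (t' : ℕ) (τ : Registers), t' ≤ t ∧ Run prim A θ P σ t' τ ∧ Q τ

theorem Exec.mono {P : Prog ι} {σ : Registers} {s t : ℕ} {Q R : Registers → Prop}
    (h : Exec prim A θ P σ s Q) (hst : s ≤ t) (hQR : ∀ τ, Q τ → R τ) : Exec prim A θ P σ t R := by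
  obtain ⟨t', τ, h₁, h₂, h₃⟩ := h
  exact ⟨t', τ, h₁.trans hst, h₂, hQR τ h₃⟩

theorem Exec.op {o : Op ι} {σ : Registers} {Q : Registers → Prop} (h : Q (o.exec prim A θ σ)) :
    Exec prim A θ (.op o) σ 1 Q :=
  ⟨1, _, le_rfl, .op o σ, h⟩

theorem Exec.seq {P P' : Prog ι} {σ : Registers} {s t : ℕ} {Q R : Registers → Prop}
    (h : Exec prim A θ P σ s Q) (h' : ∀ τ, Q τ → Exec prim A θ P' τ t R) :
    Exec prim A θ (.seq P P') σ (s + t) R := by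
  obtain ⟨s', τ, h₁, h₂, h₃⟩ := h
  obtain ⟨t', υ, k₁, k₂, k₃⟩ := h' τ h₃
  exact ⟨s' + t', υ, add_le_add h₁ k₁, .seq h₂ k₂, k₃⟩

theorem Exec.ite {a b : ℕ} {P P' : Prog ι} {σ : Registers} {t : ℕ} {Q : Registers → Prop}
    (h : σ a ≤ σ b → Exec prim A θ P σ t Q) (h' : σ b < σ a → Exec prim A θ P' σ t Q) :
    Exec prim A θ (.ite a b P P') σ (t + 1) Q := by
  rcases le_or_gt (σ a) (σ b) with hc | hc
  · obtain ⟨t', τ, h₁, h₂, h₃⟩ := h hc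
    exact ⟨t' + 1, τ, by omega, .ite_true hc h₂, h₃⟩
  · obtain ⟨t', τ, h₁, h₂, h₃⟩ := h' hc
    exact ⟨t' + 1, τ, by omega, .ite_false hc h₂, h₃⟩

/-- A loop whose invariant `I k` says that at most `k` iterations remain. -/
theorem Exec.loop {a b : ℕ} {P : Prog ι} {t : ℕ} {I : ℕ → Registers → Prop}
    (h₀ : ∀ σ, I 0 σ → σ b ≤ σ a)
    (hs : ∀ k σ, I (k + 1) σ → σ a < σ b → Exec prim A θ P σ t (I k)) (k : ℕ) :
    ∀ σ, I k σ → Exec prim A θ (.loop a b P) σ (k * (t + 1) + 1)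
      fun τ => τ b ≤ τ a ∧ ∃ j, I j τ := by
  induction k with
  | zero => exact fun σ h => ⟨1, σ, by omega, .loop_done (h₀ σ h), h₀ σ h, 0, h⟩
  | succ k ih =>
    intro σ h
    rcases le_or_gt (σ b) (σ a) with hc | hc
    · exact ⟨1, σ, by omega, .loop_done hc, hc, _, h⟩
    · obtain ⟨s, τ, h₁, h₂, h₃⟩ := hs k σ h hc
      obtain ⟨t', υ, k₁, k₂, k₃⟩ := ih τ h₃
      refine ⟨s + t' + 1, υ, ?_, .loop_step hc h₂ k₂, k₃⟩
      rw [Nat.succ_mul]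
      omega

/-- The operations in `l`, one after the other, followed by `P`. -/
def Prog.ops (l : List (Op ι)) (P : Prog ι) : Prog ι :=
  l.foldr (fun o Q => .seq (.op o) Q) P

theorem Exec.ops {P : Prog ι} {t : ℕ} {Q : Registers → Prop} (l : List (Op ι)) :
    ∀ {σ : Registers}, Exec prim A θ P (l.foldl (fun σ o => o.exec prim A θ σ) σ) t Q →
      Exec prim A θ (.ops l P) σ (l.length + t) Q := by
  induction l with
  | nil => intro σ h; exact h.mono (by simp) fun _ => id
  | cons o l ih =>
    intro σ h
    exact (Exec.seq (Exec.op (Q := fun τ => τ = o.exec prim A θ σ) rfl)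
      fun τ hτ => ih (hτ ▸ h)).mono (by simp; omega) fun _ => id

/-- The register that an operation overwrites. -/
def Op.dest : Op ι → ℕ
  | .const d _ | .move d _ | .add d _ _ | .sub d _ _ | .mul d _ _ | .div d _ _ | .sqrt d _
  | .floor d _ | .prim _ d _ | .len d | .read d _ | .bit d _ => d

/-- A bound for the registers that a program may overwrite. -/
def Prog.bound : Prog ι → ℕ
  | .op o => o.dest
  | .seq P Q => max P.bound Q.bound
  | .ite _ _ P Q => max P.bound Q.bound
  | .loop _ _ P => P.bound

theorem Op.exec_of_ne (o : Op ι) (σ : Registers) {r : ℕ} (h : r ≠ o.dest) :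
    o.exec prim A θ σ r = σ r := by
  cases o <;> exact Function.update_of_ne h _ _

/-- A program leaves all registers beyond its bound unchanged. -/
theorem Run.eq_of_bound_lt {P : Prog ι} {σ τ : Registers} {t : ℕ} (h : Run prim A θ P σ t τ)
    {r : ℕ} : P.bound < r → τ r = σ r := by
  induction h with
  | op o σ => exact fun hr => o.exec_of_ne σ (ne_of_gt hr)
  | seq _ _ ih₁ ih₂ =>
    intro hr
    simp only [Prog.bound, max_lt_iff] at hr
    rw [ih₂ hr.2, ih₁ hr.1]
  | ite_true _ _ ih => exact fun hr => ih (lt_of_le_of_lt (le_max_left _ _) hr)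
  | ite_false _ _ ih => exact fun hr => ih (lt_of_le_of_lt (le_max_right _ _) hr)
  | loop_done _ => exact fun _ => rfl
  | loop_step _ _ _ ih₁ ih₂ =>
    intro hr
    rw [ih₂ hr, ih₁ hr]

end Exec

/-! ### Ranks, counts, and the grid argument. -/

/-- The number of entries of the array `A` that lie in `S`. -/
noncomputable def count {n : ℕ} (A : Fin n → ℝ) (S : Set ℝ) : ℕ :=
  {i | A i ∈ S}.ncard

/-- The part of `(-∞, q]` on which `F` falls below `F q` by less than `δ`. -/
def leftNear (F : ℝ → ℝ) (q δ : ℝ) : Set ℝ := {x | x ≤ q ∧ F q - δ < F x}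

/-- The part of `(q, ∞)` on which `F` exceeds `F q` by less than `δ`. -/
def rightNear (F : ℝ → ℝ) (q δ : ℝ) : Set ℝ := {x | q < x ∧ F x < F q + δ}

theorem rank_eq_ncard {n : ℕ} (A : Fin n → ℝ) (q : ℝ) : rank A q = {i | A i ≤ q}.ncard := by
  rw [rank, Set.ncard_eq_toFinset_card']
  congr 1
  ext i
  simp

theorem count_comp {n : ℕ} (A : Fin n → ℝ) (S : Set ℝ) (e : Equiv.Perm (Fin n)) :
    count (A ∘ e) S = count A S := by
  unfold count
  have : {i | (A ∘ e) i ∈ S} = e ⁻¹' {i | A i ∈ S} := rfl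
  rw [this, Set.ncard_preimage_of_injective_subset_range e.injective (by simp)]

theorem rank_le {n : ℕ} (A : Fin n → ℝ) (q : ℝ) : rank A q ≤ n :=
  (Finset.card_filter_le _ _).trans (by simp)

theorem ncard_Ico {n a b : ℕ} (h : b ≤ n) : {i : Fin n | a ≤ i.1 ∧ i.1 < b}.ncard = b - a := by
  have e : {i : Fin n | a ≤ i.1 ∧ i.1 < b} = Fin.val ⁻¹' (Set.Ico a b) := rfl
  rw [e, Set.ncard_preimage_of_injective_subset_range Fin.val_injective]
  · rw [Set.ncard_eq_toFinset_card']; simp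
  · rintro i ⟨_, hi⟩
    exact ⟨⟨i, by omega⟩, rfl⟩

theorem ncard_val_lt {n : ℕ} (m : ℕ) (h : m ≤ n) : {i : Fin n | i.1 < m}.ncard = m := by
  simpa using ncard_Ico (a := 0) h

/-- In a sorted array the entries that are at most `q` come first. -/
theorem le_iff_lt_rank {n : ℕ} {A : Fin n → ℝ} (hA : Monotone A) (q : ℝ) (i : Fin n) :
    A i ≤ q ↔ i.1 < rank A q := by
  rw [rank_eq_ncard]
  constructor
  · intro h
    have : {j : Fin n | j.1 < i.1 + 1} ⊆ {i | A i ≤ q} :=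
      fun j (hj : j.1 < i.1 + 1) => (hA (Fin.le_def.2 (by omega))).trans h
    have := Set.ncard_le_ncard this
    rw [ncard_val_lt _ (by omega)] at this
    omega
  · intro h
    by_contra hq
    have : {i | A i ≤ q} ⊆ {j : Fin n | j.1 < i.1} := fun j (hj : A j ≤ q) => by
      by_contra hji
      exact hq ((hA (Fin.le_def.2 (not_lt.1 hji))).trans hj)
    have := Set.ncard_le_ncard this
    rw [ncard_val_lt _ (by omega)] at this
    omega

/-- A number `e` squeezed by a counting function `N` that on a grid is close to `M`, itself close to
the identity, is close to the place `u` where `N` passes `e`. -/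
theorem abs_sub_le_of_grid {N M : ℝ → ℝ} {e u w : ℝ} (hw : 0 < w) (hu : 0 ≤ u)
    (hlt : ∀ t, u < t → e ≤ N t) (hle : ∀ t, 0 ≤ t → t ≤ u → N t ≤ e)
    (hM : ∀ t, 0 ≤ t → M t ≤ t) (hM' : ∀ t, 0 ≤ t → t ≤ u → t ≤ M t)
    (hgrid : ∀ j ≤ ⌊w ^ 2⌋₊ + 2, |N (j * w ^ 6) - M (j * w ^ 6)| ≤ w ^ 6) (he : e ≤ w ^ 8) :
    |e - u| ≤ 2 * w ^ 6 := by
  have hw6 : 0 < w ^ 6 := by positivity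
  set j := ⌊u / w ^ 6⌋₊ with hj
  have h₁ : j * w ^ 6 ≤ u := (le_div_iff₀ hw6).1 (Nat.floor_le (by positivity))
  have h₂ : u < (j + 1) * w ^ 6 := (div_lt_iff₀ hw6).1 (Nat.lt_floor_add_one _)
  -- The grid reaches beyond u. Otherwise its last point t exceeds w^8 + w^6, whence `N t` > w^8 ≥
  -- e, although t ≤ u forces `N t` ≤ e. The summand 2 provides the strict excess over w^2 + 1.
  have hJ : j + 1 ≤ ⌊w ^ 2⌋₊ + 2 := by
    by_contra hcon
    have hjJ : ((⌊w ^ 2⌋₊ + 2 : ℕ) : ℝ) ≤ j := by exact_mod_cast (by omega)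
    have h₃ := mul_le_mul_of_nonneg_right hjJ hw6.le
    have h₄ := hgrid _ le_rfl
    have h₅ := hle _ (by positivity) (h₃.trans h₁)
    have h₆ := hM' _ (by positivity) (h₃.trans h₁)
    have h₇ := Nat.lt_floor_add_one (w ^ 2)
    have h₈ := neg_le_of_abs_le h₄
    have h₉ : (w ^ 2 + 1) * w ^ 6 < ((⌊w ^ 2⌋₊ + 2 : ℕ) : ℝ) * w ^ 6 := by
      apply mul_lt_mul_of_pos_right _ hw6
      push_cast
      linarith
    nlinarith
  have h₃ := neg_le_of_abs_le (hgrid j (by omega))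
  have h₄ := le_of_abs_le (hgrid (j + 1) hJ)
  have h₅ := hle _ (by positivity) h₁
  have h₆ := hM' _ (by positivity) h₁
  push_cast at h₄
  have h₇ := hlt _ h₂
  have h₈ := hM ((j + 1) * w ^ 6) (by positivity)
  rw [abs_le]
  constructor <;> linarith

/-- The numbers of entries near `q` are, on the grid of scale `w`, close to their means. -/
def Typical (χ : Measure ℝ) {n : ℕ} (A : Fin n → ℝ) (q w : ℝ) : Prop :=
  ∀ j ≤ ⌊w ^ 2⌋₊ + 2,
    |count A (leftNear (cdf χ) q (j * w ^ 6 / n)) -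
      n * χ.real (leftNear (cdf χ) q (j * w ^ 6 / n))| ≤ w ^ 6 ∧
    |count A (rightNear (cdf χ) q (j * w ^ 6 / n)) -
      n * χ.real (rightNear (cdf χ) q (j * w ^ 6 / n))| ≤ w ^ 6

/-! ### Masses of the near sets, and the Newton step. -/

section NearMeasure

variable {χ : Measure ℝ} [IsProbabilityMeasure χ]

theorem continuous_cdf (hχ : ∀ x, χ {x} = 0) : Continuous (cdf χ) := by
  rw [continuous_iff_continuousAt]
  intro x
  rw [(monotone_cdf χ).continuousAt_iff_leftLim_eq_rightLim, StieltjesFunction.rightLim_eq]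
  have h := (cdf χ).measure_singleton x
  rw [measure_cdf, hχ] at h
  have h' := ENNReal.ofReal_eq_zero.1 h.symm
  exact le_antisymm ((monotone_cdf χ).leftLim_le le_rfl) (by linarith)

theorem exists_cdf_eq (hχ : ∀ x, χ {x} = 0) {u : ℝ} (h₀ : 0 < u) (h₁ : u < 1) :
    ∃ y, cdf χ y = u := by
  obtain ⟨a, ha⟩ := ((tendsto_cdf_atBot χ).eventually (gt_mem_nhds h₀)).exists
  obtain ⟨b, hb⟩ := ((tendsto_cdf_atTop χ).eventually (lt_mem_nhds h₁)).exists
  exact mem_range_of_exists_le_of_exists_ge (continuous_cdf hχ) ⟨a, ha.le⟩ ⟨b, hb.le⟩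

theorem real_Ioc (a b : ℝ) (h : a ≤ b) : χ.real (Set.Ioc a b) = cdf χ b - cdf χ a := by
  rw [Measure.real, ← measure_cdf χ, StieltjesFunction.measure_Ioc, measure_cdf,
    ENNReal.toReal_ofReal (sub_nonneg.2 (monotone_cdf χ h))]

theorem real_Ioi (a : ℝ) : χ.real (Set.Ioi a) = 1 - cdf χ a := by
  rw [← Set.compl_Iic, measureReal_compl measurableSet_Iic, cdf_eq_real]
  simp

/-- Without atoms the cdf attains F(q) − δ at some y, and the set lies in (y, q]. If F(q) ≤ δ, the
whole half-line has mass at most δ. -/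
theorem real_leftNear_le (hχ : ∀ x, χ {x} = 0) (q : ℝ) {δ : ℝ} (hδ : 0 ≤ δ) :
    χ.real (leftNear (cdf χ) q δ) ≤ δ := by
  rcases le_or_gt (cdf χ q - δ) 0 with h | h
  · calc _ ≤ χ.real (Set.Iic q) := measureReal_mono fun x hx => hx.1
      _ ≤ δ := by rw [← cdf_eq_real]; linarith
  · rcases hδ.eq_or_lt with rfl | hδ
    · have : leftNear (cdf χ) q 0 = ∅ := by
        ext x
        simpa [leftNear] using fun hx => monotone_cdf χ hx
      simp [this]
    · obtain ⟨y, hy⟩ := exists_cdf_eq hχ h (by linarith [cdf_le_one χ q])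
      have hyq : y ≤ q := by
        by_contra hcon
        have := monotone_cdf χ (not_le.1 hcon).le
        linarith
      calc _ ≤ χ.real (Set.Ioc y q) := measureReal_mono fun x hx => ⟨by
              by_contra hcon
              have := monotone_cdf χ (not_lt.1 hcon)
              have := hx.2
              linarith, hx.1⟩
        _ ≤ δ := by rw [real_Ioc _ _ hyq]; linarith

/-- The slack ε keeps the level F(q) − δ + ε/2 strictly positive: for δ = F(q) the level 0 need not
be attained. It also keeps (y, q] inside a set defined by a strict inequality. -/
theorem le_real_leftNear (hχ : ∀ x, χ {x} = 0) (q : ℝ) {δ : ℝ} (h : δ ≤ cdf χ q) :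
    δ ≤ χ.real (leftNear (cdf χ) q δ) := by
  refine le_of_forall_pos_lt_add fun ε hε => ?_
  rcases le_or_gt δ (ε / 2) with hε' | hε'
  · have := measureReal_nonneg (μ := χ) (s := leftNear (cdf χ) q δ)
    linarith
  obtain ⟨y, hy⟩ := exists_cdf_eq hχ (u := cdf χ q - δ + ε / 2) (by linarith)
    (by linarith [cdf_le_one χ q])
  have hyq : y ≤ q := by
    by_contra hcon
    have := monotone_cdf χ (not_le.1 hcon).le
    linarith
  have : χ.real (Set.Ioc y q) ≤ χ.real (leftNear (cdf χ) q δ) := measureReal_mono fun x hx =>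
    ⟨hx.2, by have := monotone_cdf χ hx.1.le; linarith⟩
  rw [real_Ioc _ _ hyq] at this
  linarith

theorem real_rightNear_le (hχ : ∀ x, χ {x} = 0) (q : ℝ) {δ : ℝ} (hδ : 0 ≤ δ) :
    χ.real (rightNear (cdf χ) q δ) ≤ δ := by
  rcases le_or_gt 1 (cdf χ q + δ) with h | h
  · calc _ ≤ χ.real (Set.Ioi q) := measureReal_mono fun x hx => hx.1
      _ ≤ δ := by rw [real_Ioi]; linarith
  · rcases hδ.eq_or_lt with rfl | hδ
    · have : rightNear (cdf χ) q 0 = ∅ := by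
        ext x
        simpa [rightNear] using fun hx : q < x => monotone_cdf χ hx.le
      simp [this]
    · obtain ⟨y, hy⟩ := exists_cdf_eq hχ (u := cdf χ q + δ) (by linarith [cdf_nonneg χ q]) h
      have hyq : q ≤ y := by
        by_contra hcon
        have := monotone_cdf χ (not_le.1 hcon).le
        linarith
      calc _ ≤ χ.real (Set.Ioc q y) := measureReal_mono fun x hx => ⟨hx.1, by
              by_contra hcon
              have := monotone_cdf χ (not_le.1 hcon).le
              have := hx.2
              linarith⟩
        _ ≤ δ := by rw [real_Ioc _ _ hyq]; linarith

theorem le_real_rightNear (hχ : ∀ x, χ {x} = 0) (q : ℝ) {δ : ℝ} (h : δ ≤ 1 - cdf χ q) :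
    δ ≤ χ.real (rightNear (cdf χ) q δ) := by
  refine le_of_forall_pos_lt_add fun ε hε => ?_
  rcases le_or_gt δ (ε / 2) with hε' | hε'
  · have := measureReal_nonneg (μ := χ) (s := rightNear (cdf χ) q δ)
    linarith
  obtain ⟨y, hy⟩ := exists_cdf_eq hχ (u := cdf χ q + δ - ε / 2)
    (by linarith [cdf_nonneg χ q]) (by linarith)
  have hyq : q ≤ y := by
    by_contra hcon
    have := monotone_cdf χ (not_le.1 hcon).le
    linarith
  have : χ.real (Set.Ioc q y) ≤ χ.real (rightNear (cdf χ) q δ) := measureReal_mono fun x hx =>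
    ⟨hx.1, by have := monotone_cdf χ hx.2; linarith⟩
  rw [real_Ioc _ _ hyq] at this
  linarith

/-- One step of Newton's iteration: if the position `g` is within `w ^ 8` of the rank, the corrected
position is within `2 * w ^ 6` of it. -/
theorem abs_rank_sub_newton_le (hχ : ∀ x, χ {x} = 0) {n : ℕ} {A : Fin n → ℝ} (hA : Monotone A)
    {q w : ℝ} (hw : 0 < w) (hT : Typical χ A q w) (g : Fin n)
    (hg : |(rank A q : ℝ) - g.1| ≤ w ^ 8) :
    |(rank A q : ℝ) - ((cdf χ q - cdf χ (A g)) * n + g.1)| ≤ 2 * w ^ 6 := by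
  have hn : (0 : ℝ) < n := by exact_mod_cast g.pos
  have hr := rank_le A q
  rcases lt_or_ge g.1 (rank A q) with hgr | hgr
  · have hAg := (le_iff_lt_rank hA q g).2 hgr
    -- Here e is the length of the index block from g up to the rank. The near set at level t/n
    -- catches the whole block for t > u, and no entry outside it for t ≤ u. Its mean count is at
    -- most t, with equality as long as t/n ≤ F(q), in particular for t ≤ u.
    have key := abs_sub_le_of_grid (e := (rank A q : ℝ) - g.1) (u := (cdf χ q - cdf χ (A g)) * n)
      (N := fun t => count A (leftNear (cdf χ) q (t / n)))
      (M := fun t => n * χ.real (leftNear (cdf χ) q (t / n))) hw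
      (mul_nonneg (sub_nonneg.2 (monotone_cdf χ hAg)) hn.le) ?_ ?_ ?_ ?_
      (fun j hj => (hT j hj).1) ((le_abs_self _).trans hg)
    · convert key using 2
      ring
    · intro t ht
      have ht' := (lt_div_iff₀ hn).2 ht
      have hsub : {i : Fin n | g.1 ≤ i.1 ∧ i.1 < rank A q} ⊆
          {i | A i ∈ leftNear (cdf χ) q (t / n)} := fun i hi =>
        ⟨(le_iff_lt_rank hA q i).2 hi.2, by
          have := monotone_cdf χ (hA (Fin.le_def.2 hi.1))
          linarith⟩
      have := Set.ncard_le_ncard hsub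
      rw [ncard_Ico hr] at this
      have h2 : rank A q ≤ count A (leftNear (cdf χ) q (t / n)) + g.1 := by
        unfold count; omega
      have h3 : (rank A q : ℝ) ≤ count A (leftNear (cdf χ) q (t / n)) + g.1 := by exact_mod_cast h2
      linarith
    · intro t ht0 ht
      have ht' := (div_le_iff₀ hn).2 ht
      have hsub : {i | A i ∈ leftNear (cdf χ) q (t / n)} ⊆
          {i : Fin n | g.1 ≤ i.1 ∧ i.1 < rank A q} := fun i hi =>
        ⟨by
          by_contra hcon
          have := monotone_cdf χ (hA (Fin.le_def.2 (not_le.1 hcon).le))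
          have := hi.2
          linarith, (le_iff_lt_rank hA q i).1 hi.1⟩
      have := Set.ncard_le_ncard hsub
      rw [ncard_Ico hr] at this
      have h2 : count A (leftNear (cdf χ) q (t / n)) + g.1 ≤ rank A q := by
        unfold count; omega
      have h3 : (count A (leftNear (cdf χ) q (t / n)) + g.1 : ℝ) ≤ rank A q := by exact_mod_cast h2
      linarith
    · intro t ht
      rw [mul_comm, ← le_div_iff₀ hn]
      exact real_leftNear_le hχ q (by positivity)
    · intro t ht0 ht
      rw [mul_comm, ← div_le_iff₀ hn]
      have ht' := (div_le_iff₀ hn).2 ht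
      exact le_real_leftNear hχ q (by linarith [cdf_nonneg χ (A g)])
  · have hAg : q < A g := by
      rw [← not_le, le_iff_lt_rank hA q g]
      omega
    have key := abs_sub_le_of_grid (e := g.1 - (rank A q : ℝ)) (u := (cdf χ (A g) - cdf χ q) * n)
      (N := fun t => count A (rightNear (cdf χ) q (t / n)))
      (M := fun t => n * χ.real (rightNear (cdf χ) q (t / n))) hw
      (mul_nonneg (sub_nonneg.2 (monotone_cdf χ hAg.le)) hn.le) ?_ ?_ ?_ ?_
      (fun j hj => (hT j hj).2) ((le_abs_self _).trans (by rwa [abs_sub_comm]))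
    · rw [abs_sub_comm]
      convert key using 2
      ring
    · intro t ht
      have ht' := (lt_div_iff₀ hn).2 ht
      have hsub : {i : Fin n | rank A q ≤ i.1 ∧ i.1 < g.1} ⊆
          {i | A i ∈ rightNear (cdf χ) q (t / n)} := fun i hi =>
        ⟨by
          rw [← not_le, le_iff_lt_rank hA q i]
          exact not_lt.2 hi.1, by
          have := monotone_cdf χ (hA (Fin.le_def.2 hi.2.le))
          linarith⟩
      have := Set.ncard_le_ncard hsub
      rw [ncard_Ico g.2.le] at this
      have h2 : g.1 ≤ count A (rightNear (cdf χ) q (t / n)) + rank A q := by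
        unfold count; omega
      have h3 : (g.1 : ℝ) ≤ count A (rightNear (cdf χ) q (t / n)) + rank A q := by
        exact_mod_cast h2
      linarith
    · intro t ht0 ht
      have ht' := (div_le_iff₀ hn).2 ht
      have hsub : {i | A i ∈ rightNear (cdf χ) q (t / n)} ⊆
          {i : Fin n | rank A q ≤ i.1 ∧ i.1 < g.1} := fun i hi =>
        ⟨by
          have := hi.1
          rw [← not_le, le_iff_lt_rank hA q i] at this
          exact not_lt.1 this, by
          by_contra hcon
          have := monotone_cdf χ (hA (Fin.le_def.2 (not_lt.1 hcon)))
          have := hi.2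
          linarith⟩
      have := Set.ncard_le_ncard hsub
      rw [ncard_Ico g.2.le] at this
      have h2 : count A (rightNear (cdf χ) q (t / n)) + rank A q ≤ g.1 := by
        unfold count; omega
      have h3 : (count A (rightNear (cdf χ) q (t / n)) + rank A q : ℝ) ≤ g.1 := by
        exact_mod_cast h2
      linarith
    · intro t ht
      rw [mul_comm, ← le_div_iff₀ hn]
      exact real_rightNear_le hχ q (by positivity)
    · intro t ht0 ht
      rw [mul_comm, ← div_le_iff₀ hn]
      have ht' := (div_le_iff₀ hn).2 ht
      exact le_real_rightNear hχ q (by linarith [cdf_le_one χ (A g)])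

end NearMeasure

/-! ### The query program -/

section Program

variable {ι : Type*} (B : ℕ) (E : Prog ι)

/-- Puts the least `2 ^ 2 ^ k` that is at least `n` into `B + 8` and `2 ^ k` into `B + 9`. -/
def scaleLoop : Prog ι :=
  .loop (B + 8) (B + 2) (.ops [.mul (B + 8) (B + 8) (B + 8)] (.op (.add (B + 9) (B + 9) (B + 9))))

/-- Moves the number in `B + 11` to `B + 10`, after restricting it to `[0, n - 1]`. -/
def clampMove : Prog ι :=
  .ite (B + 11) (B + 3) (.op (.move (B + 10) (B + 3)))
    (.ite (B + 11) (B + 6) (.op (.move (B + 10) (B + 11))) (.op (.move (B + 10) (B + 6))))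

/-- One step of Newton's iteration for the position `B + 10`, with error bound `B + 8`. -/
def newtonStep : Prog ι :=
  .ops [.read 0 (B + 10)] (.seq E
    (.ops [.sub (B + 11) (B + 7) 0, .mul (B + 11) (B + 11) (B + 2),
        .add (B + 11) (B + 11) (B + 10), .floor (B + 11) (B + 11)]
      (.seq (clampMove B)
        (.ops [.sqrt (B + 11) (B + 8), .sqrt (B + 11) (B + 11), .sqrt (B + 11) (B + 11)]
          (.op (.div (B + 8) (B + 8) (B + 11)))))))

/-- Brackets the rank by the positions in `B + 12` and `B + 13`. -/
def bracket : Prog ι :=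
  .ops [.sub (B + 12) (B + 10) (B + 8), .floor (B + 12) (B + 12), .sub (B + 12) (B + 12) (B + 4),
      .add (B + 13) (B + 10) (B + 8), .floor (B + 13) (B + 13)]
    (.seq (.ite (B + 3) (B + 12) (.op (.move 0 0)) (.op (.move (B + 12) (B + 3))))
      (.seq (.ite (B + 13) (B + 6) (.op (.move 0 0)) (.op (.move (B + 13) (B + 6))))
        (.ops [.read (B + 14) (B + 12)]
          (.seq (.ite (B + 14) (B + 1) (.op (.move 0 0)) (.op (.move (B + 12) (B + 3))))
            (.ops [.read (B + 14) (B + 13)]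
              (.ite (B + 14) (B + 1) (.op (.move (B + 13) (B + 6))) (.op (.move 0 0))))))))

/-- Halves the bracket. -/
def bisect : Prog ι :=
  .ops [.add (B + 11) (B + 12) (B + 13), .div (B + 11) (B + 11) (B + 5),
      .floor (B + 11) (B + 11), .read (B + 14) (B + 11)]
    (.seq (.ite (B + 14) (B + 1) (.op (.move (B + 12) (B + 11))) (.op (.move (B + 13) (B + 11))))
      (.op (.sub (B + 11) (B + 13) (B + 12))))

/-- Binary search in the bracket. -/
def binarySearch : Prog ι :=
  .ops [.sub (B + 11) (B + 13) (B + 12)]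
    (.seq (.loop (B + 4) (B + 11) (bisect B)) (.op (.move 0 (B + 13))))

/-- Interpolation search, for a query between the least and the greatest entry. -/
def interpolationSearch : Prog ι :=
  .ops [.move 0 (B + 1)] (.seq E
    (.ops [.move (B + 7) 0, .move (B + 8) (B + 5), .move (B + 9) (B + 4)]
      (.seq (scaleLoop B)
        (.ops [.mul (B + 9) (B + 9) (B + 9), .const (B + 11) 16, .mul (B + 9) (B + 9) (B + 11),
            .mul (B + 9) (B + 9) (B + 9), .mul (B + 9) (B + 9) (B + 9), .move (B + 10) (B + 3)]
          (.seq (.loop (B + 9) (B + 8) (newtonStep B E))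
            (.seq (bracket B) (binarySearch B)))))))

/-- The query program; `E` evaluates the distribution function and overwrites no register
beyond `B`. -/
def queryProgram : Prog ι :=
  .ops [.move (B + 1) 0, .len (B + 2), .const (B + 3) 0, .const (B + 4) 1, .const (B + 5) 2,
      .sub (B + 6) (B + 2) (B + 4)]
    (.ite (B + 2) (B + 3) (.op (.const 0 0))
      (.ops [.read (B + 14) (B + 6)]
        (.ite (B + 14) (B + 1) (.op (.move 0 (B + 2)))
          (.ops [.read (B + 14) (B + 3)]
            (.ite (B + 14) (B + 1) (interpolationSearch B E) (.op (.const 0 0)))))))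

end Program

/-! ### Register invariants and the error scales. -/

/-- The registers that stay fixed during a query. -/
structure Env (B n : ℕ) (q : ℝ) (σ : Registers) : Prop where
  query : σ (B + 1) = q
  len : σ (B + 2) = n
  zero : σ (B + 3) = 0
  one : σ (B + 4) = 1
  two : σ (B + 5) = 2
  last : σ (B + 6) = n - 1

theorem Env.congr {B n : ℕ} {q : ℝ} {σ τ : Registers} (h : Env B n q σ)
    (hτ : ∀ i, 1 ≤ i → i ≤ 6 → τ (B + i) = σ (B + i)) : Env B n q τ := by
  constructor
  · rw [hτ 1 (by norm_num) (by norm_num), h.query]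
  · rw [hτ 2 (by norm_num) (by norm_num), h.len]
  · rw [hτ 3 (by norm_num) (by norm_num), h.zero]
  · rw [hτ 4 (by norm_num) (by norm_num), h.one]
  · rw [hτ 5 (by norm_num) (by norm_num), h.two]
  · rw [hτ 6 (by norm_num) (by norm_num), h.last]

theorem cell_natCast {n : ℕ} (A : Fin n → ℝ) (i : Fin n) : cell A (i.1 : ℝ) = A i := by
  simp [cell]

/-- The error bound of Newton's iteration after `i` steps is `errorRoot k i ^ 8`. -/
noncomputable def errorRoot (k i : ℕ) : ℝ := (2 : ℝ) ^ ((2 : ℝ) ^ k * (7 / 8 : ℝ) ^ i / 8)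

theorem errorRoot_pos (k i : ℕ) : 0 < errorRoot k i := Real.rpow_pos_of_pos two_pos _

theorem errorRoot_zero_pow (k : ℕ) : errorRoot k 0 ^ 8 = 2 ^ 2 ^ k := by
  rw [errorRoot, ← Real.rpow_natCast, ← Real.rpow_mul two_pos.le, ← Real.rpow_natCast 2 (2 ^ k)]
  congr 1
  push_cast
  ring

theorem errorRoot_succ_pow (k i : ℕ) : errorRoot k (i + 1) ^ 8 = errorRoot k i ^ 7 := by
  rw [errorRoot, errorRoot, ← Real.rpow_natCast, ← Real.rpow_mul two_pos.le,
    ← Real.rpow_natCast _ 7, ← Real.rpow_mul two_pos.le]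
  congr 1
  push_cast
  ring

/-- Six steps halve the exponent, since 2·(7/8)^6 ≤ 1, and k halvings bring 2^k down to at most 1.
-/
theorem errorRoot_last_pow_le (k : ℕ) : errorRoot k (6 * k) ^ 8 ≤ 2 := by
  rw [errorRoot, ← Real.rpow_natCast, ← Real.rpow_mul two_pos.le]
  have h : (2 : ℝ) ^ k * (7 / 8 : ℝ) ^ (6 * k) / 8 * (8 : ℕ) ≤ 1 := by
    rw [pow_mul]
    push_cast
    rw [div_mul_cancel₀ _ (by norm_num), ← mul_pow]
    exact pow_le_one₀ (by norm_num) (by norm_num)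
  calc _ ≤ (2 : ℝ) ^ (1 : ℝ) := Real.rpow_le_rpow_of_exponent_le one_le_two h
    _ = 2 := Real.rpow_one 2

/-- The error bound at which Newton's iteration stops. -/
noncomputable def errorGoal (k : ℕ) : ℝ := (16 * (2 ^ k) ^ 2) ^ 4

theorem errorGoal_eq (k : ℕ) : errorGoal k = 2 ^ (16 + 8 * k) := by
  rw [errorGoal, show (16 : ℝ) = 2 ^ 4 by norm_num, pow_add, pow_mul, ← pow_mul _ k 2, mul_pow,
    ← pow_mul, ← pow_mul, ← pow_mul]
  ring_nf

/-- The goal is a fourth power because the failure probability of a scale is governed by w^2. The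
bound makes 8/w^2 summable over 6k scales, and it yields w ≥ 3, as the rounding requires. -/
theorem sq_lt_of_errorGoal_lt {k : ℕ} {w : ℝ} (h : errorGoal k < w ^ 8) :
    16 * (2 ^ k) ^ 2 < w ^ 2 := by
  rw [errorGoal, show w ^ 8 = (w ^ 2) ^ 4 by ring] at h
  exact lt_of_pow_lt_pow_left₀ 4 (by positivity) h

/-- At all scales of Newton's iteration the array behaves as expected. -/
def Regular (χ : Measure ℝ) {n : ℕ} (A : Fin n → ℝ) (q : ℝ) (k : ℕ) : Prop :=
  ∀ i < 6 * k, errorGoal k < errorRoot k i ^ 8 → Typical χ A q (errorRoot k i)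

/-! ### Correctness and cost of the query program. -/

section Spec

variable {ι : Type*} {prim : ι → ℝ → ℝ} {n : ℕ} {A : Fin n → ℝ} {θ : List Bool} {q : ℝ}
  {E : Prog ι} {B c k : ℕ} {χ : Measure ℝ} {D : Set ℝ}

theorem exec_scaleLoop {p : ℝ} {σ : Registers} (hk : n ≤ 2 ^ 2 ^ k) (hk' : ∀ i < k, 2 ^ 2 ^ i < n)
    (hσ : Env B n q σ) (hp : σ (B + 7) = p) (hx : σ (B + 8) = 2) (hL : σ (B + 9) = 1) :
    Exec prim A θ (scaleLoop B) σ (k * 3 + 1) fun τ =>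
      Env B n q τ ∧ τ (B + 7) = p ∧ τ (B + 8) = 2 ^ 2 ^ k ∧ τ (B + 9) = 2 ^ k := by
  refine (Exec.loop (t := 2) (I := fun m τ => ∃ i, i + m = k ∧ Env B n q τ ∧ τ (B + 7) = p ∧
    τ (B + 8) = 2 ^ 2 ^ i ∧ τ (B + 9) = 2 ^ i) ?_ ?_ k σ ?_).mono le_rfl ?_
  · rintro σ ⟨i, hi, h, -, hx, -⟩
    obtain rfl : i = k := by omega
    rw [h.len, hx]
    exact_mod_cast hk
  · rintro m σ ⟨i, hi, h, hp, hx, hL⟩ -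
    refine (Exec.ops _ (Exec.op ⟨i + 1, by omega, h.congr ?_, ?_, ?_, ?_⟩)).mono le_rfl fun _ => id
    · intro j h1 h6
      have : j ≠ 8 ∧ j ≠ 9 := by omega
      simp [Op.exec, this]
    · simp [Op.exec, hp]
    · simp [Op.exec, hx]
      ring
    · simp [Op.exec, hL]
      ring
  · exact ⟨0, by simp, hσ, hp, by simp [hx], by simp [hL]⟩
  · rintro τ ⟨hle, m, i, hi, h, hp, hx, hL⟩
    have hik : i = k := by
      by_contra hne
      have := hk' i (by omega)
      rw [h.len, hx] at hle
      have hle' : n ≤ 2 ^ 2 ^ i := by exact_mod_cast hle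
      omega
    exact ⟨h, hp, hik ▸ hx, hik ▸ hL⟩

/-- Projection onto [0, n − 1] yields a valid index and does not increase the distance to any point
of that interval, in particular to a rank below n. -/
theorem exec_clampMove {p x T : ℝ} {v : ℤ} {σ : Registers} (hn : 0 < n)
    (hσ : Env B n q σ) (hp : σ (B + 7) = p) (hx : σ (B + 8) = x) (hT : σ (B + 9) = T)
    (hv : σ (B + 11) = v) :
    Exec prim A θ (clampMove B) σ 3 fun τ =>
      Env B n q τ ∧ τ (B + 7) = p ∧ τ (B + 8) = x ∧ τ (B + 9) = T ∧
      ∃ g : Fin n, τ (B + 10) = (g.1 : ℝ) ∧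
        ∀ r : ℝ, 0 ≤ r → r ≤ n - 1 → |r - g.1| ≤ |r - v| := by
  have key : ∀ (a : ℕ) (g : Fin n), σ a = (g.1 : ℝ) →
      (∀ r : ℝ, 0 ≤ r → r ≤ n - 1 → |r - g.1| ≤ |r - v|) →
      Exec prim A θ (.op (.move (B + 10) a)) σ 1 fun τ =>
      Env B n q τ ∧ τ (B + 7) = p ∧ τ (B + 8) = x ∧ τ (B + 9) = T ∧
      ∃ g : Fin n, τ (B + 10) = (g.1 : ℝ) ∧
        ∀ r : ℝ, 0 ≤ r → r ≤ n - 1 → |r - g.1| ≤ |r - v| := by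
    intro a g hg hr
    refine Exec.op ⟨hσ.congr ?_, ?_, ?_, ?_, g, ?_, hr⟩
    · intro j h1 h6
      have : j ≠ 10 := by omega
      simp [Op.exec, this]
    all_goals simp [Op.exec, *]
  refine Exec.ite (t := 2) (fun h => ?_) fun h => Exec.ite (t := 1) (fun h' => ?_) fun h' => ?_
  · rw [hσ.zero, hv] at h
    refine (key _ ⟨0, hn⟩ (by simp [hσ.zero]) fun r h0 h1 => ?_).mono (by norm_num) fun _ => id
    simp only [Nat.cast_zero, sub_zero]
    rw [abs_of_nonneg h0]
    exact le_trans (by linarith) (le_abs_self _)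
  · rw [hσ.zero, hv] at h
    rw [hσ.last, hv] at h'
    have h0 : 0 < v := by exact_mod_cast h
    have h1 : v ≤ n - 1 := by exact_mod_cast h'
    obtain ⟨m, rfl⟩ := Int.eq_ofNat_of_zero_le h0.le
    exact key _ ⟨m, by omega⟩ (by simp [hv]) fun r _ _ => by simp
  · rw [hσ.last, hv] at h'
    refine key _ ⟨n - 1, by omega⟩ ?_ fun r h0 h1 => ?_
    · rw [hσ.last, Nat.cast_sub hn, Nat.cast_one]
    · simp only
      rw [Nat.cast_sub hn, Nat.cast_one, abs_sub_comm, abs_of_nonneg (by linarith), abs_sub_comm]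
      exact le_trans (by linarith) (le_abs_self _)

/-- The error claim is conditional while halting and the register contents are not, so the same run
serves regular and irregular arrays. Three square roots extract w from w^8, and division gives the
next bound w^7. -/
theorem exec_newtonStep [IsProbabilityMeasure χ] (hχ : ∀ x, χ {x} = 0)
    (hE : ∀ σ, σ 0 ∈ D → Exec prim A θ E σ c fun τ => τ 0 = cdf χ (σ 0) ∧ ∀ r, B < r → τ r = σ r)
    (hA : Monotone A) (hD : ∀ i, A i ∈ D) (hr : rank A q < n)
    {T w : ℝ} {g : Fin n} {σ : Registers} (hw : 0 < w) (hσ : Env B n q σ)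
    (hp : σ (B + 7) = cdf χ q) (hx : σ (B + 8) = w ^ 8) (hT : σ (B + 9) = T)
    (hg : σ (B + 10) = (g.1 : ℝ)) :
    Exec prim A θ (newtonStep B E) σ (c + 12) fun τ =>
      Env B n q τ ∧ τ (B + 7) = cdf χ q ∧ τ (B + 8) = w ^ 7 ∧ τ (B + 9) = T ∧
      ∃ g' : Fin n, τ (B + 10) = (g'.1 : ℝ) ∧
        (Typical χ A q w → 3 ≤ w → |(rank A q : ℝ) - g.1| ≤ w ^ 8 →
          |(rank A q : ℝ) - g'.1| ≤ w ^ 7) := by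
  have hroot : √√√(w ^ 8) = w := by
    rw [show w ^ 8 = ((w ^ 2) ^ 2) ^ 2 by ring, Real.sqrt_sq (by positivity),
      Real.sqrt_sq (by positivity), Real.sqrt_sq hw.le]
  refine (Exec.ops _ (Exec.seq (hE _ ?_) fun τ hτ => Exec.ops _ (Exec.seq (exec_clampMove
    (n := n) (q := q) (p := cdf χ q) (x := w ^ 8) (T := T)
    (v := ⌊(cdf χ q - cdf χ (A g)) * n + g.1⌋) g.pos (hσ.congr ?_) ?_ ?_ ?_ ?_)
    fun υ hυ => Exec.ops _ (Exec.op (Q := fun τ =>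
      Env B n q τ ∧ τ (B + 7) = cdf χ q ∧ τ (B + 8) = w ^ 7 ∧ τ (B + 9) = T ∧
      ∃ g' : Fin n, τ (B + 10) = (g'.1 : ℝ) ∧
        (Typical χ A q w → 3 ≤ w → |(rank A q : ℝ) - g.1| ≤ w ^ 8 →
          |(rank A q : ℝ) - g'.1| ≤ w ^ 7)) ?_)))).mono ?_ fun _ => id
  · simp [Op.exec, hg, cell_natCast, hD]
  · intro j h1 h6
    have h11 : j ≠ 11 := by omega
    have := hτ.2 (B + j) (by omega)
    simp [Op.exec, Function.update_apply, h11, this]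
    omega
  · simp [Op.exec, hτ.2, hp]
  · simp [Op.exec, hτ.2, hx]
  · simp [Op.exec, hτ.2, hT]
  · simp [Op.exec, hτ.2, hτ.1, hp, hg, hσ.len, cell_natCast]
  · obtain ⟨h₁, h₂, h₃, h₄, g', h₅, h₆⟩ := hυ
    refine ⟨h₁.congr ?_, ?_, ?_, ?_, g', ?_, ?_⟩
    · intro j h1 h6
      have : j ≠ 11 ∧ j ≠ 8 := by omega
      simp [Op.exec, this]
    · simp [Op.exec, h₂]
    · simp [Op.exec, h₃, hroot]
      field_simp
    · simp [Op.exec, h₄]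
    · simp [Op.exec, h₅]
    · intro ht h3 hgr
      have hr' : (rank A q : ℝ) ≤ n - 1 := by
        have : rank A q + 1 ≤ n := hr
        have : (rank A q + 1 : ℝ) ≤ n := by exact_mod_cast this
        linarith
      have hnew := abs_le.1 (abs_rank_sub_newton_le hχ hA hw ht g hgr)
      have hfl := Int.floor_le ((cdf χ q - cdf χ (A g)) * n + g.1)
      have hfl' := Int.lt_floor_add_one ((cdf χ q - cdf χ (A g)) * n + g.1)
      -- The summand 1 pays for rounding down; w ≥ 3 absorbs both terms.
      have h6 : 2 * w ^ 6 + 1 ≤ w ^ 7 := by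
        have h1 : 1 ≤ w ^ 6 := one_le_pow₀ (by linarith)
        have : w ^ 7 = w * w ^ 6 := by ring
        nlinarith
      refine (h₆ _ (by positivity) hr').trans (abs_le.2 ⟨?_, ?_⟩) <;> linarith
  · simp; omega

/-- The loop test involves only the error bound, which evolves independently of the data, so 6k
rounds suffice on every array. -/
theorem exec_newtonLoop [IsProbabilityMeasure χ] (hχ : ∀ x, χ {x} = 0)
    (hE : ∀ σ, σ 0 ∈ D → Exec prim A θ E σ c fun τ => τ 0 = cdf χ (σ 0) ∧ ∀ r, B < r → τ r = σ r)
    (hA : Monotone A) (hD : ∀ i, A i ∈ D) (hr : rank A q < n) (hk : n ≤ 2 ^ 2 ^ k)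
    {σ : Registers} (hσ : Env B n q σ) (hp : σ (B + 7) = cdf χ q)
    (hx : σ (B + 8) = 2 ^ 2 ^ k) (hT : σ (B + 9) = errorGoal k) (hg : σ (B + 10) = 0) :
    Exec prim A θ (.loop (B + 9) (B + 8) (newtonStep B E)) σ (6 * k * (c + 13) + 1) fun τ =>
      Env B n q τ ∧ ∃ x, τ (B + 8) = x ∧ 0 ≤ x ∧ x ≤ errorGoal k ∧
      ∃ g : Fin n, τ (B + 10) = (g.1 : ℝ) ∧ (Regular χ A q k → |(rank A q : ℝ) - g.1| ≤ x) := by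
  refine (Exec.loop (t := c + 12) (I := fun m τ => ∃ i, i + m = 6 * k ∧ Env B n q τ ∧
    τ (B + 7) = cdf χ q ∧ τ (B + 8) = errorRoot k i ^ 8 ∧ τ (B + 9) = errorGoal k ∧
    ∃ g : Fin n, τ (B + 10) = (g.1 : ℝ) ∧
      (Regular χ A q k → |(rank A q : ℝ) - g.1| ≤ errorRoot k i ^ 8)) ?_ ?_ (6 * k) σ ?_).mono
      le_rfl ?_
  · rintro σ ⟨i, hi, -, -, hx, hT, -⟩
    obtain rfl : i = 6 * k := by omega
    rw [hx, hT]
    refine (errorRoot_last_pow_le k).trans ?_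
    rw [errorGoal_eq]
    exact le_self_pow₀ one_le_two (by omega)
  · rintro m σ ⟨i, hi, h, hp, hx, hT, g, hg, hgr⟩ hlt
    rw [hx, hT] at hlt
    refine (exec_newtonStep hχ hE hA hD hr (errorRoot_pos k i) h hp hx hT hg).mono le_rfl ?_
    rintro τ ⟨h₁, h₂, h₃, h₄, g', h₅, h₆⟩
    refine ⟨i + 1, by omega, h₁, h₂, by rw [h₃, errorRoot_succ_pow], h₄, g', h₅, fun hR => ?_⟩
    rw [errorRoot_succ_pow]
    refine h₆ (hR i (by omega) hlt) ?_ (hgr hR)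
    have h1 := sq_lt_of_errorGoal_lt hlt
    have h2 : (1 : ℝ) ≤ (2 ^ k) ^ 2 := one_le_pow₀ (one_le_pow₀ one_le_two)
    nlinarith [errorRoot_pos k i]
  · refine ⟨0, by simp, hσ, hp, by rw [hx, errorRoot_zero_pow], hT, ⟨0, by omega⟩, by simp [hg],
      fun _ => ?_⟩
    rw [errorRoot_zero_pow]
    have : (rank A q : ℝ) ≤ 2 ^ 2 ^ k := by exact_mod_cast hr.le.trans hk
    simpa using this
  · rintro τ ⟨hle, m, i, hi, h₁, h₂, h₃, h₄, g, h₅, h₆⟩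
    rw [h₃, h₄] at hle
    exact ⟨h₁, _, h₃, (pow_pos (errorRoot_pos k i) 8).le, hle, g, h₅, h₆⟩

/-- The bracket is valid unconditionally because an end that fails its comparison with q is reset to
the end of the array; only its width depends on `S`. Under `S` the rank is within x of g, and
neither reset fires. Subtracting 1 from the lower floor makes that end strictly smaller than the
rank. -/
theorem exec_bracket (hA : Monotone A) {x : ℝ} {g : Fin n} {σ : Registers} {S : Prop}
    (h₀ : 0 < rank A q) (hr : rank A q < n) (hσ : Env B n q σ) (hx : σ (B + 8) = x) (hx₀ : 0 ≤ x)
    (hg : σ (B + 10) = (g.1 : ℝ)) (hS : S → |(rank A q : ℝ) - g.1| ≤ x) :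
    Exec prim A θ (bracket B) σ 15 fun τ =>
      Env B n q τ ∧ ∃ lo hi : Fin n, τ (B + 12) = (lo.1 : ℝ) ∧ τ (B + 13) = (hi.1 : ℝ) ∧
        A lo ≤ q ∧ q < A hi ∧ (S → (hi.1 : ℝ) - lo.1 ≤ 2 * x + 2) := by
  have hn : 0 < n := by omega
  have hlast : ((n - 1 : ℕ) : ℝ) = n - 1 := by rw [Nat.cast_sub hn, Nat.cast_one]
  set r := rank A q with hrdef
  have hg0 : (0 : ℝ) ≤ g.1 := by positivity
  have hgn : (g.1 : ℝ) ≤ n - 1 := by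
    rw [← hlast]
    exact_mod_cast (by omega : g.1 ≤ n - 1)
  have hlo := Int.floor_le ((g.1 : ℝ) - x)
  have hlo' := Int.lt_floor_add_one ((g.1 : ℝ) - x)
  have hhi := Int.floor_le ((g.1 : ℝ) + x)
  have hhi' := Int.lt_floor_add_one ((g.1 : ℝ) + x)
  refine (Exec.ops _ (Exec.seq (t := 8) (Q := fun τ => Env B n q τ ∧
      τ (B + 13) = (⌊(g.1 : ℝ) + x⌋ : ℝ) ∧ ∃ lo : Fin n, τ (B + 12) = (lo.1 : ℝ) ∧
        (S → lo.1 < r ∧ (g.1 : ℝ) - x - 2 ≤ lo.1)) (Exec.ite (t := 1) ?_ ?_)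
    fun τ hτ => Exec.seq (t := 6) (Q := fun τ => Env B n q τ ∧ ∃ lo hi : Fin n,
        τ (B + 12) = (lo.1 : ℝ) ∧ τ (B + 13) = (hi.1 : ℝ) ∧
        (S → (lo.1 < r ∧ r ≤ hi.1) ∧ (hi.1 : ℝ) - lo.1 ≤ 2 * x + 2)) (Exec.ite (t := 1) ?_ ?_)
    fun τ hτ => Exec.ops _ (Exec.seq (t := 3) (Q := fun τ => Env B n q τ ∧ ∃ lo hi : Fin n,
        τ (B + 12) = (lo.1 : ℝ) ∧ τ (B + 13) = (hi.1 : ℝ) ∧ A lo ≤ q ∧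
        (S → r ≤ hi.1 ∧ (hi.1 : ℝ) - lo.1 ≤ 2 * x + 2)) (Exec.ite (t := 1) ?_ ?_)
    fun τ hτ => Exec.ops _ (Exec.ite (t := 1) ?_ ?_)))).mono (by simp) fun _ => id
  · intro h
    simp [Op.exec, hg, hx, hσ.zero, hσ.one] at h
    have h' : (0 : ℤ) ≤ ⌊(g.1 : ℝ) - x⌋ - 1 := by
      have : (1 : ℤ) ≤ ⌊(g.1 : ℝ) - x⌋ := by exact_mod_cast h
      omega
    obtain ⟨m, hm⟩ := Int.eq_ofNat_of_zero_le h'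
    have hm' : (m : ℝ) = ⌊(g.1 : ℝ) - x⌋ - 1 := by exact_mod_cast hm.symm
    have hmn : m < n := by
      have : (m : ℝ) < n := by linarith
      exact_mod_cast this
    refine Exec.op ⟨hσ.congr ?_, ?_, ⟨m, hmn⟩, ?_, fun hs => ⟨?_, ?_⟩⟩
    · intro j h1 h6
      have : j ≠ 0 ∧ j ≠ 12 ∧ j ≠ 13 := by omega
      simp [Op.exec, this]
    · simp [Op.exec, hg, hx]
    · simp [Op.exec, hg, hx, hm', hσ.one]
    · have := abs_le.1 (hS hs)
      have : (m : ℝ) < r := by linarith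
      exact_mod_cast this
    · simp only
      linarith
  · intro h
    simp [Op.exec, hg, hx, hσ.zero, hσ.one] at h
    refine Exec.op ⟨hσ.congr ?_, ?_, ⟨0, hn⟩, ?_, fun hs => ⟨h₀, ?_⟩⟩
    · intro j h1 h6
      have : j ≠ 0 ∧ j ≠ 12 ∧ j ≠ 13 := by omega
      simp [Op.exec, this]
    · simp [Op.exec, hg, hx]
    · simp [Op.exec, hσ.zero]
    · simp only [Nat.cast_zero]
      linarith
  · obtain ⟨h₁, h₂, lo, h₃, h₄⟩ := hτ
    intro h
    rw [h₂, h₁.last] at h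
    have h0 : (0 : ℤ) ≤ ⌊(g.1 : ℝ) + x⌋ := Int.floor_nonneg.2 (by positivity)
    obtain ⟨m, hm⟩ := Int.eq_ofNat_of_zero_le h0
    rw [hm] at h h₂ hhi hhi'
    have hmn : m < n := by
      have : (m : ℝ) < n := by push_cast at h; linarith
      exact_mod_cast this
    refine Exec.op ⟨h₁.congr ?_, lo, ⟨m, hmn⟩, ?_, ?_, fun hs => ⟨⟨(h₄ hs).1, ?_⟩, ?_⟩⟩
    · intro j h1 h6
      have : j ≠ 0 := by omega
      simp [Op.exec, this]
    · simp [Op.exec, h₃]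
    · simp [Op.exec, h₂]
    · have := abs_le.1 (hS hs)
      have : (r : ℝ) < m + 1 := by push_cast at hhi'; linarith
      exact Nat.lt_succ_iff.1 (by exact_mod_cast this)
    · have := (h₄ hs).2
      push_cast at hhi
      simp only
      linarith
  · obtain ⟨h₁, h₂, lo, h₃, h₄⟩ := hτ
    intro h
    rw [h₂, h₁.last] at h
    refine Exec.op ⟨h₁.congr ?_, lo, ⟨n - 1, by omega⟩, ?_, ?_,
      fun hs => ⟨⟨(h₄ hs).1, by simp only; omega⟩, ?_⟩⟩
    · intro j h1 h6
      have : j ≠ 0 ∧ j ≠ 13 := by omega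
      simp [Op.exec, this]
    · simp [Op.exec, h₃]
    · simp [Op.exec, h₁.last, hlast]
    · have := (h₄ hs).2
      simp only
      linarith
  · obtain ⟨h₁, lo, hi, h₂, h₃, h₄⟩ := hτ
    intro h
    simp [Op.exec, h₂, h₁.query, cell_natCast] at h
    refine Exec.op ⟨h₁.congr ?_, lo, hi, ?_, ?_, h, fun hs => ⟨(h₄ hs).1.2, (h₄ hs).2⟩⟩
    · intro j h1 h6
      have : j ≠ 0 ∧ j ≠ 14 := by omega
      simp [Op.exec, this]
    · simp [Op.exec, h₂]
    · simp [Op.exec, h₃]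
  · obtain ⟨h₁, lo, hi, h₂, h₃, h₄⟩ := hτ
    intro h
    simp [Op.exec, h₂, h₁.query, cell_natCast] at h
    refine Exec.op ⟨h₁.congr ?_, ⟨0, hn⟩, hi, ?_, ?_, (le_iff_lt_rank hA q _).2 h₀, fun hs => ?_⟩
    · intro j h1 h6
      have : j ≠ 0 ∧ j ≠ 14 ∧ j ≠ 12 := by omega
      simp [Op.exec, this]
    · simp [Op.exec, h₁.zero]
    · simp [Op.exec, h₃]
    · exact absurd ((le_iff_lt_rank hA q lo).2 (h₄ hs).1.1) (not_le.2 h)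
  · obtain ⟨h₁, lo, hi, h₂, h₃, h₄, h₅⟩ := hτ
    intro h
    simp [Op.exec, h₃, h₁.query, cell_natCast] at h
    refine Exec.op ⟨h₁.congr ?_, lo, ⟨n - 1, by omega⟩, ?_, ?_, h₄, ?_, fun hs => ?_⟩
    · intro j h1 h6
      have : j ≠ 0 ∧ j ≠ 14 ∧ j ≠ 13 := by omega
      simp [Op.exec, this]
    · simp [Op.exec, h₂]
    · simp [Op.exec, h₁.last, hlast]
    · rw [← not_le, le_iff_lt_rank hA]
      simp only
      omega
    · exact absurd ((le_iff_lt_rank hA q hi).1 h) (not_lt.2 (h₅ hs).1)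
  · obtain ⟨h₁, lo, hi, h₂, h₃, h₄, h₅⟩ := hτ
    intro h
    simp [Op.exec, h₃, h₁.query, cell_natCast] at h
    refine Exec.op ⟨h₁.congr ?_, lo, hi, ?_, ?_, h₄, h, fun hs => (h₅ hs).2⟩
    · intro j h1 h6
      have : j ≠ 0 ∧ j ≠ 14 := by omega
      simp [Op.exec, this]
    · simp [Op.exec, h₂]
    · simp [Op.exec, h₃]

theorem exec_bisect {m : ℕ} {lo hi : Fin n} {σ : Registers} (hσ : Env B n q σ)
    (h₁ : σ (B + 12) = (lo.1 : ℝ)) (h₂ : σ (B + 13) = (hi.1 : ℝ)) (h₃ : A lo ≤ q) (h₄ : q < A hi)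
    (hlt : lo.1 + 1 < hi.1) (hm : hi.1 - lo.1 ≤ 2 ^ (m + 1)) :
    Exec prim A θ (bisect B) σ 7 fun τ => Env B n q τ ∧
      ∃ lo hi : Fin n, τ (B + 12) = (lo.1 : ℝ) ∧ τ (B + 13) = (hi.1 : ℝ) ∧
        τ (B + 11) = (hi.1 : ℝ) - lo.1 ∧ A lo ≤ q ∧ q < A hi ∧ hi.1 - lo.1 ≤ 2 ^ m := by
  rw [pow_succ] at hm
  have hmid : (lo.1 + hi.1) / 2 < n := by omega
  have hfl : (⌊((lo.1 : ℝ) + hi.1) / 2⌋ : ℝ) = (((lo.1 + hi.1) / 2 : ℕ) : ℝ) := by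
    have h₅ : (2 * ((lo.1 + hi.1) / 2 : ℕ) : ℝ) ≤ lo.1 + hi.1 := by
      exact_mod_cast Nat.mul_div_le (lo.1 + hi.1) 2
    have h₆ : (lo.1 + hi.1 : ℝ) < 2 * ((lo.1 + hi.1) / 2 : ℕ) + 2 := by
      exact_mod_cast (by omega : lo.1 + hi.1 < 2 * ((lo.1 + hi.1) / 2) + 2)
    have : ⌊((lo.1 : ℝ) + hi.1) / 2⌋ = (((lo.1 + hi.1) / 2 : ℕ) : ℤ) := by
      rw [Int.floor_eq_iff, Int.cast_natCast]
      constructor <;> linarith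
    rw [this, Int.cast_natCast]
  have hc : cell A (((lo.1 + hi.1) / 2 : ℕ) : ℝ) = A ⟨_, hmid⟩ := cell_natCast A ⟨_, hmid⟩
  refine (Exec.ops _ (Exec.seq (t := 1) (Q := fun τ => Env B n q τ ∧
      ∃ lo hi : Fin n, τ (B + 12) = (lo.1 : ℝ) ∧ τ (B + 13) = (hi.1 : ℝ) ∧
        A lo ≤ q ∧ q < A hi ∧ hi.1 - lo.1 ≤ 2 ^ m)
    (Exec.ite (t := 1) ?_ ?_) fun τ hτ => Exec.op ?_)).mono (by simp) fun _ => id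
  · intro h
    simp only [List.foldl, Op.exec, Function.update_apply, Nat.add_left_cancel_iff, h₁, h₂, hfl, hc,
      hσ.two, hσ.query, Nat.reduceEqDiff, if_true, if_false, OfNat.one_ne_ofNat] at h
    refine Exec.op ⟨hσ.congr ?_, ⟨_, hmid⟩, hi, ?_, ?_, h, h₄, ?_⟩
    · intro j h1 h6
      have : j ≠ 11 ∧ j ≠ 12 ∧ j ≠ 14 := by omega
      simp [Op.exec, this]
    · simp [Op.exec, h₁, h₂, hσ.two, hfl]
    · simp [Op.exec, h₂]
    · simp only
      omega
  · intro h
    simp only [List.foldl, Op.exec, Function.update_apply, Nat.add_left_cancel_iff, h₁, h₂, hfl, hc,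
      hσ.two, hσ.query, Nat.reduceEqDiff, if_true, if_false, OfNat.one_ne_ofNat] at h
    refine Exec.op ⟨hσ.congr ?_, lo, ⟨_, hmid⟩, ?_, ?_, h₃, h, ?_⟩
    · intro j h1 h6
      have : j ≠ 11 ∧ j ≠ 13 ∧ j ≠ 14 := by omega
      simp [Op.exec, this]
    · simp [Op.exec, h₁]
    · simp [Op.exec, h₁, h₂, hσ.two, hfl]
    · simp only
      omega
  · obtain ⟨h, lo, hi, k₁, k₂, k₃, k₄, k₅⟩ := hτ
    refine ⟨h.congr ?_, lo, hi, ?_, ?_, ?_, k₃, k₄, k₅⟩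
    · intro j h1 h6
      have : j ≠ 11 := by omega
      simp [Op.exec, this]
    all_goals simp [Op.exec, k₁, k₂]

theorem exec_binarySearch (hA : Monotone A) {m : ℕ} {lo hi : Fin n} {σ : Registers}
    (hσ : Env B n q σ) (h₁ : σ (B + 12) = (lo.1 : ℝ)) (h₂ : σ (B + 13) = (hi.1 : ℝ))
    (h₃ : A lo ≤ q) (h₄ : q < A hi) (hm : hi.1 - lo.1 ≤ 2 ^ m) :
    Exec prim A θ (binarySearch B) σ (8 * m + 3) fun τ => τ 0 = rank A q := by
  refine (Exec.ops _ (Exec.seq (Exec.loop (t := 7) (I := fun m τ => Env B n q τ ∧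
      ∃ lo hi : Fin n, τ (B + 12) = (lo.1 : ℝ) ∧ τ (B + 13) = (hi.1 : ℝ) ∧
        τ (B + 11) = (hi.1 : ℝ) - lo.1 ∧ A lo ≤ q ∧ q < A hi ∧ hi.1 - lo.1 ≤ 2 ^ m)
      ?_ ?_ m _ ?_) fun τ hτ => Exec.op (Q := fun τ => τ 0 = rank A q) ?_)).mono
      (by simp; omega) fun _ => id
  · rintro σ ⟨h, lo, hi, -, -, k₃, -, -, k₆⟩
    rw [k₃, h.one]
    have : (hi.1 : ℝ) ≤ lo.1 + 1 := by exact_mod_cast (by omega)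
    linarith
  · rintro m σ ⟨h, lo, hi, k₁, k₂, k₃, k₄, k₅, k₆⟩ hlt
    rw [k₃, h.one] at hlt
    refine exec_bisect h k₁ k₂ k₄ k₅ ?_ k₆
    have : (lo.1 + 1 : ℝ) < hi.1 := by linarith
    exact_mod_cast this
  · refine ⟨hσ.congr ?_, lo, hi, ?_, ?_, ?_, h₃, h₄, hm⟩
    · intro j h1 h6
      have : j ≠ 11 := by omega
      simp [Op.exec, this]
    all_goals simp [Op.exec, h₁, h₂]
  · obtain ⟨hle, j, h, lo, hi, k₁, k₂, k₃, k₄, k₅, -⟩ := hτ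
    rw [k₃, h.one] at hle
    have hle' : (hi.1 : ℝ) ≤ lo.1 + 1 := by linarith
    have hle'' : hi.1 ≤ lo.1 + 1 := by exact_mod_cast hle'
    rw [le_iff_lt_rank hA] at k₄
    rw [← not_le, le_iff_lt_rank hA] at k₅
    -- The invariant gives lo < rank ≤ hi, and the loop ends with hi ≤ lo + 1.
    have : hi.1 = rank A q := by omega
    simp [Op.exec, k₂, this]

/-- The query program is correct; the number of operations is bounded in terms of the number `m` of
steps of the binary search, which is small for a regular array. -/
theorem exec_queryProgram [IsProbabilityMeasure χ] (hχ : ∀ x, χ {x} = 0) (hDc : D.OrdConnected)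
    (hE : ∀ σ, σ 0 ∈ D → Exec prim A θ E σ c fun τ => τ 0 = cdf χ (σ 0) ∧ ∀ r, B < r → τ r = σ r)
    (hA : Monotone A) (hD : ∀ i, A i ∈ D) (hk : n ≤ 2 ^ 2 ^ k) (hk' : ∀ i < k, 2 ^ 2 ^ i < n)
    {m : ℕ} (hm : n ≤ 2 ^ m ∨ Regular χ A q k ∧ 18 + 8 * k ≤ m) :
    Exec prim A θ (queryProgram B E) (initial q) (8 * m + 6 * k * (c + 13) + k * 3 + (c + 50))
      fun τ => τ 0 = rank A q := by
  set σ : Registers := List.foldl (fun σ o => Op.exec prim A θ σ o) (initial q)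
    [.move (B + 1) 0, .len (B + 2), .const (B + 3) 0, .const (B + 4) 1, .const (B + 5) 2,
      .sub (B + 6) (B + 2) (B + 4)] with hσdef
  have hσ : Env B n q σ := by
    constructor <;> simp [hσdef, Op.exec, initial]
  refine (Exec.ops _ (Exec.ite (t := 8 * m + 6 * k * (c + 13) + k * 3 + (c + 40)) (fun h => ?_)
    fun h => (Exec.ops _ (Exec.ite (t := 8 * m + 6 * k * (c + 13) + k * 3 + (c + 37))
      (fun h' => ?_) fun h' => (Exec.ops _ (Exec.ite
        (t := 8 * m + 6 * k * (c + 13) + k * 3 + (c + 34)) (fun h'' => ?_) fun h'' => ?_)).mono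
      (by simp; omega) fun _ => id)).mono (by simp; omega) fun _ => id)).mono
      (by simp; omega) fun _ => id
  · rw [← hσdef, hσ.len, hσ.zero] at h
    have hn : n = 0 := by exact_mod_cast le_antisymm h (by positivity)
    have hr := rank_le A q
    have hr0 : rank A q = 0 := by omega
    exact (Exec.op (by simp [Op.exec, hr0])).mono (by omega) fun _ => id
  all_goals
    rw [← hσdef, hσ.len, hσ.zero] at h
    have hn : 0 < n := by exact_mod_cast h
    have hlast : cell A ((n : ℝ) - 1) = A ⟨n - 1, by omega⟩ := by
      rw [← cell_natCast A, Nat.cast_sub hn, Nat.cast_one]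
    rw [← hσdef] at h'
    simp only [List.foldl_cons, List.foldl_nil] at h'
    simp only [Op.exec, Function.update_self, hσ.last, hlast, ne_eq,
      Nat.add_left_cancel_iff, OfNat.one_ne_ofNat, not_false_eq_true, Function.update_of_ne,
      hσ.query] at h'
  · rw [le_iff_lt_rank hA] at h'
    simp only at h'
    have hr := rank_le A q
    have hr0 : rank A q = n := by omega
    refine (Exec.op ?_).mono (by omega) fun _ => id
    rw [← hσdef]
    simp only [List.foldl_cons, List.foldl_nil]
    simp [Op.exec, hσ.len, hr0]
  all_goals
    have hr : rank A q < n := by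
      rw [← not_le, le_iff_lt_rank hA] at h'
      simp only at h'
      omega
    have hzero : cell A 0 = A ⟨0, hn⟩ := by rw [← cell_natCast A, Nat.cast_zero]
    rw [← hσdef] at h''
    simp only [List.foldl_cons, List.foldl_nil] at h''
    simp only [Op.exec, Function.update_self, ne_eq, Nat.reduceEqDiff,
      Nat.add_left_cancel_iff, OfNat.one_ne_ofNat, not_false_eq_true, Function.update_of_ne,
      hσ.query, hσ.zero, hzero] at h''
  · have h₀ : 0 < rank A q := (le_iff_lt_rank hA q _).1 h''
    -- The evaluator is guaranteed only on `D`. Since q lies between two entries, convexity puts it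
    -- there; queries outside this range were answered without evaluating F.
    have hq : q ∈ D := hDc.out (hD _) (hD _) ⟨h'', h'.le⟩
    rw [← hσdef]
    simp only [List.foldl_cons, List.foldl_nil]
    set υ : Registers := (Op.read (B + 14) (B + 3) : Op ι).exec prim A θ
      ((Op.read (B + 14) (B + 6) : Op ι).exec prim A θ σ) with hυdef
    have hυ : Env B n q υ := hσ.congr fun j h1 h6 => by
      have : j ≠ 14 := by omega
      simp [hυdef, Op.exec, this]
    refine (Exec.ops _ (Exec.seq (hE _ ?_) fun τ hτ => Exec.ops _ (Exec.seq
      (exec_scaleLoop (p := cdf χ q) hk hk' (hυ.congr ?_) ?_ ?_ ?_) fun τ hτ => Exec.ops _ (Exec.seq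
      (t := 8 * m + 18) (exec_newtonLoop hχ hE hA hD hr hk (hτ.1.congr ?_) ?_ ?_ ?_ ?_) ?_)))).mono
      (t := 8 * m + 6 * k * (c + 13) + k * 3 + (c + 34)) ?_ fun _ => id
    · simp [Op.exec, hυ.query, hq]
    · intro j h1 h6
      have h11 : j ≠ 7 ∧ j ≠ 8 ∧ j ≠ 9 := by omega
      have := hτ.2 (B + j) (by omega)
      simp [Op.exec, Function.update_apply, h11, this]
      omega
    · simp [Op.exec, hτ.1, hυ.query]
    · simp [Op.exec, hτ.2, hυ.two]
    · simp [Op.exec, hτ.2, hυ.one]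
    · intro j h1 h6
      have h11 : j ≠ 9 ∧ j ≠ 10 ∧ j ≠ 11 := by omega
      simp [Op.exec, h11]
    · simp [Op.exec, hτ]
    · simp [Op.exec, hτ]
    · simp [Op.exec, hτ, errorGoal]
      ring
    · simp [Op.exec, hτ.1.zero]
    · rintro τ ⟨h₁, x, h₂, h₃, h₄, g, h₅, h₆⟩
      refine (Exec.seq (exec_bracket hA h₀ hr h₁ h₂ h₃ h₅ h₆) fun τ hτ => ?_).mono
        (s := 15 + (8 * m + 3)) (by omega) fun _ => id
      obtain ⟨k₁, lo, hi, k₂, k₃, k₄, k₅, k₆⟩ := hτ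
      refine exec_binarySearch hA k₁ k₂ k₃ k₄ k₅ ?_
      rcases hm with hm | ⟨hR, hm⟩
      · have := hi.2
        omega
      · have h7 := k₆ hR
        have h8 : (hi.1 : ℝ) ≤ lo.1 + 2 ^ (18 + 8 * k) := by
          have h9 : (2 : ℝ) ^ (18 + 8 * k) = 4 * errorGoal k := by rw [errorGoal_eq]; ring
          have h10 : 1 ≤ errorGoal k := by rw [errorGoal_eq]; exact one_le_pow₀ one_le_two
          linarith
        have h11 : hi.1 ≤ lo.1 + 2 ^ (18 + 8 * k) := by exact_mod_cast h8
        have h12 : 2 ^ (18 + 8 * k) ≤ 2 ^ m := Nat.pow_le_pow_right (by norm_num) hm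
        exact Nat.sub_le_iff_le_add'.2 (h11.trans (Nat.add_le_add_left h12 _))
    · simp; omega
  · rw [← not_le, le_iff_lt_rank hA] at h''
    simp only at h''
    have hr0 : rank A q = 0 := by omega
    refine (Exec.op ?_).mono (by omega) fun _ => id
    simp [Op.exec, hr0]

end Spec

/-! ### Concentration of the counts. -/

theorem measurableSet_leftNear (χ : Measure ℝ) (q δ : ℝ) : MeasurableSet (leftNear (cdf χ) q δ) :=
  measurableSet_Iic.inter (measurableSet_lt measurable_const (monotone_cdf χ).measurable)

theorem measurableSet_rightNear (χ : Measure ℝ) (q δ : ℝ) : MeasurableSet (rightNear (cdf χ) q δ) :=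
  measurableSet_Ioi.inter (measurableSet_lt (monotone_cdf χ).measurable measurable_const)

section Concentration

variable {χ : Measure ℝ} [IsProbabilityMeasure χ]

/-- **Chebyshev's inequality** for the number of samples that lie in a set. -/
theorem measure_count_le (n : ℕ) {S : Set ℝ} (hS : MeasurableSet S) {d : ℝ} (hd : 0 < d) :
    (Measure.pi fun _ : Fin n => χ) {X | d ≤ |(count X S : ℝ) - n * χ.real S|} ≤
      ENNReal.ofReal (n * χ.real S / d ^ 2) := by
  set f : ℝ → ℝ := S.indicator 1 with hf
  have hfm : MemLp f 2 χ := memLp_indicator_const 2 hS 1 (Or.inr (measure_ne_top _ _))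
  set Y : (Fin n → ℝ) → ℝ := ∑ i : Fin n, fun X => f (X i) with hY
  have hcount : ∀ X, (count X S : ℝ) = Y X := by
    classical
    intro X
    rw [hY, Finset.sum_apply, count, Set.ncard_eq_toFinset_card']
    simp [hf, Set.indicator_apply]
  have hYm : MemLp Y 2 (Measure.pi fun _ : Fin n => χ) :=
    memLp_finsetSum' _ fun i _ => hfm.comp_measurePreserving (measurePreserving_eval _ i)
  have hint : χ[f] = χ.real S := by
    rw [hf, integral_indicator_one hS]
  have hmean : (∫ X, Y X ∂(Measure.pi fun _ : Fin n => χ)) = n * χ.real S := by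
    have h1 : ∀ i : Fin n, ∫ X, f (X i) ∂(Measure.pi fun _ : Fin n => χ) = χ.real S := fun i => by
      rw [← hint]
      exact integral_comp_eval (μ := fun _ : Fin n => χ) (i := i) hfm.1
    simp only [hY, Finset.sum_apply]
    rw [integral_finsetSum]
    · simp [h1]
    · exact fun i _ => (hfm.comp_measurePreserving (measurePreserving_eval _ i)).integrable
        one_le_two
  have hvar : Var[Y; Measure.pi fun _ : Fin n => χ] ≤ n * χ.real S := by
    rw [hY, variance_sum_pi (μ := fun _ : Fin n => χ) (X := fun _ => f) fun _ => hfm]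
    -- The variance is at most the second moment, and an indicator equals its own square.
    have : Var[f; χ] ≤ χ.real S := by
      refine (variance_le_expectation_sq hfm.1).trans (le_of_eq ?_)
      rw [← hint]
      congr 1
      ext x
      by_cases hx : x ∈ S <;> simp [hf, hx]
    simpa using mul_le_mul_of_nonneg_left this (Nat.cast_nonneg (α := ℝ) n)
  have key := meas_ge_le_variance_div_sq hYm hd
  rw [hmean] at key
  simp only [hcount]
  exact key.trans (ENNReal.ofReal_le_ofReal (div_le_div_of_nonneg_right hvar (by positivity)))

/-- Sorting destroys independence but not counts, so events about the sorted array can be estimated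
on the product space. -/
theorem count_sort {n : ℕ} (X : Fin n → ℝ) (S : Set ℝ) : count (X ∘ Tuple.sort X) S = count X S :=
  count_comp X S _

/-- A sample is untypical at scale `w` with probability `O(1 / w ^ 2)`. -/
theorem measure_not_typical_le (hχ : ∀ x, χ {x} = 0) {n : ℕ} (hn : 0 < n) (q : ℝ) {w : ℝ}
    (hw : 2 ≤ w) :
    (Measure.pi fun _ : Fin n => χ) {X | ¬ Typical χ (X ∘ Tuple.sort X) q w} ≤
      ENNReal.ofReal (8 / w ^ 2) := by
  set μ := Measure.pi fun _ : Fin n => χ with hμ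
  set J := ⌊w ^ 2⌋₊ + 2 with hJ
  have hw0 : 0 < w := by linarith
  have hd : 0 < w ^ 6 := by positivity
  have hn' : (0 : ℝ) < n := by exact_mod_cast hn
  let dev : Set ℝ → Set (Fin n → ℝ) := fun S => {X | w ^ 6 ≤ |(count X S : ℝ) - n * χ.real S|}
  have hsub : {X : Fin n → ℝ | ¬ Typical χ (X ∘ Tuple.sort X) q w} ⊆
      ⋃ j ∈ Finset.range (J + 1), (dev (leftNear (cdf χ) q (j * w ^ 6 / n)) ∪
        dev (rightNear (cdf χ) q (j * w ^ 6 / n))) := by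
    intro X hX
    simp only [Typical, count_sort, Set.mem_ofPred_eq, not_forall, not_and_or, not_le] at hX
    obtain ⟨j, hj, h⟩ := hX
    refine Set.mem_biUnion (x := j) (by simp; omega) ?_
    exact h.imp le_of_lt le_of_lt
  -- Variance at most j·w^6 against the squared deviation w^12.
  have hone : ∀ (j : ℕ) (S : Set ℝ), MeasurableSet S → χ.real S ≤ j * w ^ 6 / n →
      μ (dev S) ≤ ENNReal.ofReal (j / w ^ 6) := by
    intro j S hS hle
    refine (measure_count_le n hS hd).trans (ENNReal.ofReal_le_ofReal ?_)
    rw [le_div_iff₀ hn'] at hle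
    rw [div_le_div_iff₀ (by positivity) hd]
    nlinarith
  calc μ {X | ¬ Typical χ (X ∘ Tuple.sort X) q w}
      ≤ ∑ j ∈ Finset.range (J + 1), μ (dev (leftNear (cdf χ) q (j * w ^ 6 / n)) ∪
        dev (rightNear (cdf χ) q (j * w ^ 6 / n))) :=
        (measure_mono hsub).trans (measure_biUnion_finset_le _ _)
    _ ≤ ∑ j ∈ Finset.range (J + 1), ENNReal.ofReal (2 * (J / w ^ 6)) := by
        refine Finset.sum_le_sum fun j hj => ?_
        have hjJ : (j : ℝ) ≤ J := by
          have := Finset.mem_range.1 hj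
          exact_mod_cast (by omega : j ≤ J)
        rw [two_mul, ENNReal.ofReal_add (by positivity) (by positivity)]
        have hle : ENNReal.ofReal (j / w ^ 6) ≤ ENNReal.ofReal (J / w ^ 6) :=
          ENNReal.ofReal_le_ofReal (div_le_div_of_nonneg_right hjJ hd.le)
        exact (measure_union_le _ _).trans (add_le_add
          ((hone j _ (measurableSet_leftNear _ _ _)
            (real_leftNear_le hχ q (by positivity))).trans hle)
          ((hone j _ (measurableSet_rightNear _ _ _)
            (real_rightNear_le hχ q (by positivity))).trans hle))
    _ = ENNReal.ofReal ((J + 1) * (2 * (J / w ^ 6))) := by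
        rw [Finset.sum_const, Finset.card_range, nsmul_eq_mul, ← ENNReal.ofReal_natCast,
          ← ENNReal.ofReal_mul (by positivity), Nat.cast_succ]
    _ ≤ ENNReal.ofReal (8 / w ^ 2) := by
        refine ENNReal.ofReal_le_ofReal ?_
        have hJle : (J : ℝ) ≤ w ^ 2 + 2 := by
          rw [hJ]
          push_cast
          linarith [Nat.floor_le (sq_nonneg w)]
        have h4 : 4 ≤ w ^ 2 := by nlinarith
        have hJ0 : (0 : ℝ) ≤ J := by positivity
        rw [show ((J : ℝ) + 1) * (2 * (J / w ^ 6)) = 2 * (J * (J + 1)) / w ^ 6 by ring,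
          div_le_div_iff₀ hd (by positivity)]
        -- With J ≤ w^2 + 2 and w^2 ≥ 4, this turns 2J(J + 1)/w^6 into 8/w^2.
        have h5 : (J : ℝ) * (J + 1) ≤ 4 * (w ^ 2 * w ^ 2) := by nlinarith
        nlinarith [sq_nonneg w]

/-- A sample is irregular with probability `O(1 / log n)`. -/
theorem measure_not_regular_le (hχ : ∀ x, χ {x} = 0) {n : ℕ} (hn : 0 < n) (q : ℝ) (k : ℕ) :
    (Measure.pi fun _ : Fin n => χ) {X | ¬ Regular χ (X ∘ Tuple.sort X) q k} ≤
      ENNReal.ofReal (3 / 2 ^ k) := by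
  have hk : (k : ℝ) ≤ 2 ^ k := by exact_mod_cast Nat.lt_two_pow_self.le
  have h2 : (0 : ℝ) < 2 ^ k := by positivity
  have hsub : {X : Fin n → ℝ | ¬ Regular χ (X ∘ Tuple.sort X) q k} ⊆
      ⋃ i ∈ Finset.range (6 * k), {X | errorGoal k < errorRoot k i ^ 8 ∧
        ¬ Typical χ (X ∘ Tuple.sort X) q (errorRoot k i)} := by
    intro X hX
    simp only [Regular, Set.mem_ofPred_eq, not_forall] at hX
    obtain ⟨i, hi, h, h'⟩ := hX
    exact Set.mem_biUnion (x := i) (by simpa using hi) ⟨h, h'⟩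
  calc _ ≤ ∑ i ∈ Finset.range (6 * k), (Measure.pi fun _ : Fin n => χ)
        {X | errorGoal k < errorRoot k i ^ 8 ∧ ¬ Typical χ (X ∘ Tuple.sort X) q (errorRoot k i)} :=
        (measure_mono hsub).trans (measure_biUnion_finset_le _ _)
    _ ≤ ∑ i ∈ Finset.range (6 * k), ENNReal.ofReal (1 / (2 * (2 ^ k) ^ 2)) := by
        refine Finset.sum_le_sum fun i _ => ?_
        by_cases h : errorGoal k < errorRoot k i ^ 8
        · have h1 := sq_lt_of_errorGoal_lt h
          have h3 : (1 : ℝ) ≤ (2 ^ k) ^ 2 := one_le_pow₀ (one_le_pow₀ one_le_two)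
          simp only [h, true_and]
          refine (measure_not_typical_le hχ hn q ?_).trans (ENNReal.ofReal_le_ofReal ?_)
          · nlinarith [errorRoot_pos k i]
          · rw [div_le_div_iff₀ (by nlinarith) (by positivity)]
            nlinarith
        · simp [h]
    _ = ENNReal.ofReal ((6 * k) * (1 / (2 * (2 ^ k) ^ 2))) := by
        rw [Finset.sum_const, Finset.card_range, nsmul_eq_mul, ← ENNReal.ofReal_natCast,
          ← ENNReal.ofReal_mul (by positivity), Nat.cast_mul, Nat.cast_ofNat]
    -- The sum is 3k/4^k, and k ≤ 2^k.
    _ ≤ ENNReal.ofReal (3 / 2 ^ k) := by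
        refine ENNReal.ofReal_le_ofReal ?_
        rw [mul_one_div, div_le_div_iff₀ (by positivity) h2]
        nlinarith

end Concentration

/-! ### Expected cost and the final constant. -/

/-- The expectation of a quantity that is at most `b` outside of a null set, and at most `a` outside
of a set of small measure. -/
theorem expectation_le {Ω : Type*} [MeasurableSpace Ω] (μ : Measure Ω) [IsProbabilityMeasure μ]
    {T : Ω → ℝ≥0∞} {G : Ω → Prop} {a b ε : ℝ≥0∞} (hb : ∀ᵐ ω ∂μ, T ω ≤ a + b)
    (ha : ∀ᵐ ω ∂μ, G ω → T ω ≤ a) (hG : μ {ω | ¬ G ω} ≤ ε) : expectation μ T ≤ a + b * ε := by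
  set N := toMeasurable μ {ω | ¬ (T ω ≤ a + b ∧ (G ω → T ω ≤ a))} with hN
  have hN0 : μ N = 0 := by
    rw [hN, measure_toMeasurable]
    exact hb.and ha
  set U := toMeasurable μ {ω | ¬ G ω} with hU
  have hNm : MeasurableSet N := measurableSet_toMeasurable _ _
  have hUm : MeasurableSet U := measurableSet_toMeasurable _ _
  -- A measurable majorant built from measurable hulls, since neither `T` nor the bad event is
  -- assumed measurable: `b` is added on the hull of the bad event, and ∞ on a null set.
  have hg : ∀ ω, T ω ≤ a + U.indicator (fun _ => b) ω + N.indicator (fun _ => ⊤) ω := by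
    intro ω
    by_cases h : ω ∈ N
    · simp [h]
    · have h' : T ω ≤ a + b ∧ (G ω → T ω ≤ a) := by
        by_contra hcon
        exact h (subset_toMeasurable _ _ hcon)
      by_cases hω : ω ∈ U
      · simpa [h, hω] using h'.1
      · have : G ω := by
          by_contra hcon
          exact hω (subset_toMeasurable _ _ hcon)
        simpa [h, hω] using h'.2 this
  have hgm : Measurable fun ω => a + U.indicator (fun _ => b) ω + N.indicator (fun _ => ⊤) ω :=
    (measurable_const.add (measurable_const.indicator hUm)).add (measurable_const.indicator hNm)
  calc expectation μ T ≤ ∫⁻ ω, a + U.indicator (fun _ => b) ω + N.indicator (fun _ => ⊤) ω ∂μ :=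
        iInf_le_of_le _ (iInf_le_of_le hgm (iInf_le_of_le hg le_rfl))
    _ = a + b * μ {ω | ¬ G ω} := by
        rw [lintegral_add_right _ (measurable_const.indicator hNm),
          lintegral_add_right _ (measurable_const.indicator hUm), lintegral_indicator_const hUm,
          lintegral_indicator_const hNm, hN0, lintegral_const, hU, measure_toMeasurable]
        simp
    _ ≤ a + b * ε := by gcongr

theorem exists_scale (n : ℕ) : ∃ k, n ≤ 2 ^ 2 ^ k ∧ ∀ i < k, 2 ^ 2 ^ i < n := by
  have h : ∃ k, n ≤ 2 ^ 2 ^ k :=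
    ⟨n, Nat.lt_two_pow_self.le.trans (Nat.pow_le_pow_right two_pos Nat.lt_two_pow_self.le)⟩
  classical
  exact ⟨Nat.find h, Nat.find_spec h, fun i hi => not_le.1 (Nat.find_min h hi)⟩

theorem loglog_three_pos : 0 < Real.log (Real.log 3) := by
  refine Real.log_pos ?_
  rw [Real.lt_log_iff_exp_lt (by norm_num)]
  exact Real.exp_one_lt_three

/-- For k = i + 1, two logarithms of 2^(2^i) < n give i·log 2 + log log 2 < log log n. Here log 2 >
1/2 supplies both log log 2 ≥ −log 2 and the factor 2. -/
theorem scale_le_loglog {n k : ℕ} (hn : 3 ≤ n) (hk : ∀ i < k, 2 ^ 2 ^ i < n) :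
    (k : ℝ) ≤ 2 + 2 * Real.log (Real.log n) := by
  have hl2 := Real.log_two_gt_d9
  have hn3 : (3 : ℝ) ≤ n := by exact_mod_cast hn
  have hlog3 : Real.log 3 ≤ Real.log n := Real.log_le_log (by norm_num) hn3
  have hlog3' : 0 < Real.log 3 := Real.log_pos (by norm_num)
  have hpos : 0 ≤ Real.log (Real.log n) :=
    loglog_three_pos.le.trans (Real.log_le_log hlog3' hlog3)
  rcases k with _ | i
  · push_cast
    linarith
  · have h1 : ((2 : ℝ) ^ 2 ^ i) < n := by exact_mod_cast hk i (by omega)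
    have h2 := Real.log_lt_log (by positivity) h1
    rw [Real.log_pow] at h2
    push_cast at h2
    have h3 := Real.log_lt_log (by positivity) h2
    rw [Real.log_mul (by positivity) (by positivity), Real.log_pow] at h3
    have h4 : -Real.log 2 ≤ Real.log (Real.log 2) := by
      rw [← Real.log_inv]
      exact Real.log_le_log (by norm_num) (by norm_num; linarith)
    push_cast
    nlinarith

/-- The index that stores the bits needed by the evaluator `E` and runs the query program. -/
def interpolationIndex {ι : Type*} (E : Prog ι) (θ : List Bool) : LearnedIndex ι where
  params _ := θ
  query := queryProgram E.bound E

/-- The number of operations for `k` scales and `m` steps of the binary search. -/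
def queryCost (c k m : ℕ) : ℕ := 8 * m + 6 * k * (c + 13) + k * 3 + (c + 50)

section Index

variable {ι : Type*} {prim : ι → ℝ → ℝ} {χ : Measure ℝ} [IsProbabilityMeasure χ] {D : Set ℝ}
  {E : Prog ι} {θ : List Bool} {c : ℕ}

theorem expectedTime_interpolationIndex_le (hχ : ∀ x, χ {x} = 0) (hDc : D.OrdConnected)
    (hD : ∀ᵐ x ∂χ, x ∈ D)
    (hE : ∀ (n : ℕ) (A : Fin n → ℝ) (σ : Registers), σ 0 ∈ D → Exec prim A θ E σ c
      fun τ => τ 0 = cdf χ (σ 0) ∧ ∀ r, E.bound < r → τ r = σ r)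
    {n k : ℕ} (hn : 0 < n) (hk : n ≤ 2 ^ 2 ^ k) (hk' : ∀ i < k, 2 ^ 2 ^ i < n) (q : ℝ) :
    (interpolationIndex E θ).expectedTime prim χ n q ≤
      ENNReal.ofReal (queryCost c k (18 + 8 * k) + 24) := by
  have htime : ∀ (A : Fin n → ℝ) (m : ℕ), Monotone A → (∀ i, A i ∈ D) →
      (n ≤ 2 ^ m ∨ Regular χ A q k ∧ 18 + 8 * k ≤ m) →
      (interpolationIndex E θ).time prim A q ≤ (queryCost c k m : ℝ≥0∞) := by
    intro A m hA hAD hm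
    obtain ⟨t, τ, ht, hrun, -⟩ := exec_queryProgram hχ hDc (hE n A) hA hAD hk hk' hm
    exact iInf_le_of_le t (iInf_le_of_le τ (iInf_le_of_le hrun (by exact_mod_cast ht)))
  have hae : ∀ᵐ X ∂(Measure.pi fun _ : Fin n => χ), ∀ i, X i ∈ D :=
    ae_all_iff.2 fun i =>
      (measurePreserving_eval (fun _ : Fin n => χ) i).quasiMeasurePreserving.ae hD
  -- On any sorted array in `D`, 2^k bisection steps suffice because n ≤ 2^(2^k). Replacing 18 + 8k
  -- steps by 2^k adds at most 8·2^k operations, and 8·2^k · 3/2^k = 24.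
  refine (expectation_le (a := queryCost c k (18 + 8 * k)) (b := (8 * 2 ^ k : ℕ))
    (ε := ENNReal.ofReal (3 / 2 ^ k)) (G := fun X => Regular χ (X ∘ Tuple.sort X) q k) _ ?_ ?_
    (measure_not_regular_le hχ hn q k)).trans ?_
  · filter_upwards [hae] with X hX
    refine (htime _ (2 ^ k) (Tuple.monotone_sort X) (fun i => hX _) (Or.inl hk)).trans ?_
    rw [← Nat.cast_add, Nat.cast_le]
    unfold queryCost
    omega
  · filter_upwards [hae] with X hX hR
    exact htime _ _ (Tuple.monotone_sort X) (fun i => hX _) (Or.inr ⟨hR, le_rfl⟩)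
  · rw [ENNReal.ofReal_add (by positivity) (by norm_num), ENNReal.ofReal_natCast]
    refine add_le_add le_rfl ?_
    rw [← ENNReal.ofReal_natCast, ← ENNReal.ofReal_mul (by positivity)]
    refine ENNReal.ofReal_le_ofReal (le_of_eq ?_)
    push_cast
    field_simp
    norm_num

end Index

theorem exists_learnedIndex (c s : ℕ) :
    ∃ C : ℝ, ∀ (ι : Type*) (prim : ι → ℝ → ℝ) (D : Set ℝ) (χ : Measure ℝ) [IsProbabilityMeasure χ],
      D.OrdConnected → (∀ᵐ x ∂χ, x ∈ D) → (∀ x : ℝ, χ {x} = 0) →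
      EvaluableOn prim (cdf χ) D c s →
      ∃ R : LearnedIndex ι,
        R.Correct prim D ∧
        (∀ (n : ℕ) (A : Fin n → ℝ), Monotone A → (∀ i, A i ∈ D) → (R.space A : ℝ) ≤ C) ∧
        ∀ n : ℕ, 3 ≤ n → ∀ q : ℝ,
          R.expectedTime prim χ n q ≤ ENNReal.ofReal (C * Real.log (Real.log n)) := by
  have hl := loglog_three_pos
  set l := Real.log (Real.log 3) with hldef
  set a : ℝ := c + 218 with ha
  set b : ℝ := 6 * (c + 13) + 67 with hb
  -- The summand s covers the space. The expected cost is at most a + b·k, hence at most a + 2b +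
  -- 2b·log log n. Since log log n ≥ l > 0 for n ≥ 3, dividing by l absorbs the constant part.
  refine ⟨s + ((a + 2 * b) / l + 2 * b), ?_⟩
  intro ι prim D χ _ hDc hD hχ hF
  obtain ⟨E, θ, hθ, hE⟩ := hF
  have hE' : ∀ (n : ℕ) (A : Fin n → ℝ) (σ : Registers), σ 0 ∈ D → Exec prim A θ E σ c
      fun τ => τ 0 = cdf χ (σ 0) ∧ ∀ r, E.bound < r → τ r = σ r := by
    intro n A σ h
    obtain ⟨t, τ, ht, hrun, h0⟩ := hE n A σ h
    exact ⟨t, τ, ht, hrun, h0, fun r hr => hrun.eq_of_bound_lt hr⟩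
  refine ⟨interpolationIndex E θ, ?_, ?_, ?_⟩
  · intro n A hA hAD q
    obtain ⟨k, hk, hk'⟩ := exists_scale n
    obtain ⟨t, τ, -, hrun, h0⟩ :=
      exec_queryProgram hχ hDc (hE' n A) hA hAD hk hk' (q := q) (Or.inl hk)
    exact ⟨t, τ, hrun, h0⟩
  · intro n A _ _
    have : ((interpolationIndex E θ).space A : ℝ) ≤ s := by exact_mod_cast hθ
    have : 0 ≤ (a + 2 * b) / l + 2 * b := by positivity
    linarith
  · intro n hn q
    obtain ⟨k, hk, hk'⟩ := exists_scale n
    refine (expectedTime_interpolationIndex_le hχ hDc hD hE' (by omega) hk hk' q).trans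
      (ENNReal.ofReal_le_ofReal ?_)
    have hkl := scale_le_loglog hn hk'
    set x := Real.log (Real.log n) with hx
    have hlx : l ≤ x := by
      refine Real.log_le_log (Real.log_pos (by norm_num)) (Real.log_le_log (by norm_num) ?_)
      exact_mod_cast hn
    have hcost : (queryCost c k (18 + 8 * k) : ℝ) + 24 = a + b * k := by
      simp only [queryCost, ha, hb]
      push_cast
      ring
    have hb0 : 0 ≤ b := by positivity
    have h1 : a + 2 * b ≤ (a + 2 * b) / l * x := by
      rw [div_mul_eq_mul_div, le_div_iff₀ hl]
      exact mul_le_mul_of_nonneg_left hlx (by positivity)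
    have h2 : b * k ≤ b * (2 + 2 * x) := mul_le_mul_of_nonneg_left hkl hb0
    have h3 : 0 ≤ (s : ℝ) * x := mul_nonneg (Nat.cast_nonneg s) (hl.le.trans hlx)
    rw [hcost]
    linarith

end LearnedIndexing

theorem theorem2 (c s : ℕ) :
    ∃ C : ℝ, ∀ (ι : Type*) (prim : ι → ℝ → ℝ) (D : Set ℝ) (χ : Measure ℝ) [IsProbabilityMeasure χ],
      D.OrdConnected → (∀ᵐ x ∂χ, x ∈ D) → (∀ x : ℝ, χ {x} = 0) →
      LearnedIndexing.EvaluableOn prim (cdf χ) D c s →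
      ∃ R : LearnedIndexing.LearnedIndex ι,
        R.Correct prim D ∧
        (∀ (n : ℕ) (A : Fin n → ℝ), Monotone A → (∀ i, A i ∈ D) → (R.space A : ℝ) ≤ C) ∧
        ∀ n : ℕ, 3 ≤ n → ∀ q : ℝ,
          R.expectedTime prim χ n q ≤ ENNReal.ofReal (C * Real.log (Real.log n)) :=
  LearnedIndexing.exists_learnedIndex c s
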